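/- Let $(M,\omega)$ be a smooth symplectic manifold of dimension $2n+2$ ($n\ge 0$), let $H:M\to\mathbb R$ be smooth with Hamiltonian vector field $X_H$, $i_{X_H}\omega=-dH$, and let $\mathbf D$ be a smooth vector field on $M$ that is a scaling symmetry of degree $\Lambda\in\mathbb R$: $L_{\mathbf D}\omega=\omega$ and $L_{\mathbf D}H=\Lambda H$. Put $\lambda:=i_{\mathbf D}\omega$. Suppose that the space $C=M/\mathbf D$ of orbits of $\mathbf D$ (two points being identified when they lie on a common integral curve of $\mathbf D$) is a smooth manifold of dimension $2n+1$ such that the projection $\pi:M\to C$ is a surjective smooth submersion. A (global) scaling function is a smooth nowhere vanishing $\rho:M\to\mathbb R$ with $L_{\mathbf D}\rho=\rho$. Real powers of negative numbers: fix a sign $\varepsilon\in\{1,-1\}$ and put, for $x\neq 0$, $x^{\Lambda}:=|x|^\Lambda$ if $x>0$, $x^\Lambda:=\varepsilon|x|^\Lambda$ if $x<0$, and $x^{1-\Lambda}:=x/x^{\Lambda}$. (If $\rho>0$ the choice of $\varepsilon$ is irrelevant; if $\Lambda$ is an integer, $\varepsilon=(-1)^\Lambda$ gives the usual powers.) Then,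 for every scaling function $\rho$: 1. There are a unique contact form $\eta$ on $C$ with $\pi^*\eta=\lambda/\rho$ and a unique smooth function $\mathscr H_0:C\to\mathbb R$ with $\pi^*\mathscr H_0=-H/\rho^{\Lambda}$; there are a unique Reeb vector field $\mathscr R$ of $\eta$ ($i_{\mathscr R}d\eta=0$, $i_{\mathscr R}\eta=1$) and a unique contact Hamiltonian vector field $X_{\mathscr H_0}$ of $\mathscr H_0$ with respect to $\eta$ ($i_{X_{\mathscr H_0}}d\eta=d\mathscr H_0-\mathscr R(\mathscr H_0)\,\eta$, $i_{X_{\mathscr H_0}}\eta=-\mathscr H_0$). 2. The line field $\ell:=\pi_*\,\mathrm{span}(X_H)$ on $C$ is well defined and is spanned by $$X:=X_{\mathscr H_0}+(1-\Lambda)\,\mathscr H_0\,\mathscr R ,$$ that is, $d\pi_m(\mathrm{span}\,X_H(m))=\mathrm{span}\,X(\pi(m))$ for every $m\in M$. 3. If $\tilde\rho$ is another scaling function and $\tilde X$ is the vector field on $C$ obtained in the same way from $\tilde\rho$, then $\tilde\rho/\rho$ descends to a smooth function on $C$ and $$\tilde X=\left(\frac{\tilde\rho}{\rho}\right)^{1-\Lambda}X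 .$$ -/

import Mathlib

open scoped Manifold ContDiff

noncomputable section

namespace ScalingReduction

/-! ### Differential forms on manifolds without boundary -/

section Forms

variable {E : Type*} [NormedAddCommGroup E] [NormedSpace ℝ E]
  {M : Type*} [TopologicalSpace M] [ChartedSpace E M] {k : ℕ}

/-- (Not necessarily smooth) vector fields on `M`. -/
abbrev VField (E : Type*) [NormedAddCommGroup E] [NormedSpace ℝ E]
    (M : Type*) [TopologicalSpace M] [ChartedSpace E M] : Type _ :=
  ∀ x : M, TangentSpace 𝓘(ℝ, E) x

/-- (Not necessarily smooth) real-valued differential `k`-forms on `M`. -/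
abbrev DForm (E : Type*) [NormedAddCommGroup E] [NormedSpace ℝ E]
    (M : Type*) [TopologicalSpace M] [ChartedSpace E M] (k : ℕ) : Type _ :=
  ∀ x : M, TangentSpace 𝓘(ℝ, E) x [⋀^Fin k]→L[ℝ] ℝ

/-- A vector field is smooth if it is a smooth section of the tangent bundle. -/
def VField.Smooth [IsManifold 𝓘(ℝ, E) ∞ M] (X : VField E M) : Prop :=
  ContMDiff 𝓘(ℝ, E) 𝓘(ℝ, E).tangent ∞ (fun x => (⟨x, X x⟩ : TangentBundle 𝓘(ℝ, E) M))

/-- The differential `df_x(v)` of a real-valued function. -/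
def dfun (f : M → ℝ) (x : M) (v : TangentSpace 𝓘(ℝ, E) x) : ℝ :=
  mfderiv 𝓘(ℝ, E) 𝓘(ℝ, ℝ) f x v

/-- The derivative `X(f) = L_X f = df(X)` of a function along a vector field. -/
def VField.deriv (X : VField E M) (f : M → ℝ) (x : M) : ℝ :=
  dfun f x (X x)

/-- The expression of a `k`-form in the preferred chart at `x₀`, that is, its pullback under the
inverse of that chart. Only the values on the target of the chart are meaningful. -/
def DForm.inChart (α : DForm E M k) (x₀ : M) (y : E) : E [⋀^Fin k]→L[ℝ] ℝ :=
  (α ((extChartAt 𝓘(ℝ, E) x₀).symm y)).compContinuousLinearMap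
    (mfderiv 𝓘(ℝ, E) 𝓘(ℝ, E) (extChartAt 𝓘(ℝ, E) x₀).symm y)

/-- A form is smooth if its expressions in charts are smooth. -/
def DForm.Smooth (α : DForm E M k) : Prop :=
  ∀ x₀ : M, ContDiffOn ℝ ∞ (α.inChart x₀) (extChartAt 𝓘(ℝ, E) x₀).target

/-- The exterior derivative, computed at `x` in the preferred chart at `x`
(for smooth forms any chart gives the same result). -/
def DForm.d (α : DForm E M k) : DForm E M (k + 1) := fun x =>
  (extDeriv (α.inChart x) (extChartAt 𝓘(ℝ, E) x x)).compContinuousLinearMap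
    (mfderiv 𝓘(ℝ, E) 𝓘(ℝ, E) (extChartAt 𝓘(ℝ, E) x) x)

/-- The interior product `i_X α = α(X, ·, …, ·)`. -/
def DForm.interior (X : VField E M) (α : DForm E M (k + 1)) : DForm E M k := fun x =>
  ContinuousAlternatingMap.curryLeft (E := E) (α x) (X x)

/-- The Lie derivative of a form of positive degree, `L_X α = d(i_X α) + i_X(dα)`. -/
def DForm.lieDeriv (X : VField E M) (α : DForm E M (k + 1)) : DForm E M (k + 1) := fun x =>
  DForm.d (DForm.interior X α) x + DForm.interior X (DForm.d α) x

end Forms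

/-! ### Symplectic and contact Hamiltonian systems -/

section Systems

variable {E : Type*} [NormedAddCommGroup E] [NormedSpace ℝ E]
  {M : Type*} [TopologicalSpace M] [ChartedSpace E M]

/-- Symplectic forms: smooth closed nondegenerate 2-forms. -/
structure IsSymplectic (Ω : DForm E M 2) : Prop where
  smooth : Ω.Smooth
  closed : ∀ x, Ω.d x = 0
  nondegenerate : ∀ (x : M) (u : TangentSpace 𝓘(ℝ, E) x),
    (∀ v : TangentSpace 𝓘(ℝ, E) x, Ω x ![u, v] = 0) → u = 0

/-- `X` is the Hamiltonian vector field of `H`: `i_X Ω = -dH`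
(this determines `X`, which is smooth when `H` is). -/
def IsHamiltonianField (Ω : DForm E M 2) (H : M → ℝ) (X : VField E M) : Prop :=
  ∀ (x : M) (v : TangentSpace 𝓘(ℝ, E) x),
    Ω x ![X x, v] = -dfun H x v

/-- Contact forms: smooth nowhere vanishing 1-forms `η` such that `dη` is nondegenerate on
`ker η` (for a manifold of dimension `2n+1` this says `η ∧ (dη)ⁿ ≠ 0` everywhere). -/
structure IsContactForm (η : DForm E M 1) : Prop where
  smooth : η.Smooth
  ne_zero : ∀ x, η x ≠ 0
  nondegenerate : ∀ (x : M) (u : TangentSpace 𝓘(ℝ, E) x), η x ![u] = 0 →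
    (∀ v : TangentSpace 𝓘(ℝ, E) x, η x ![v] = 0 → η.d x ![u, v] = 0) → u = 0

/-- `R` is the Reeb vector field of `η`: `i_R dη = 0` and `i_R η = 1`. -/
structure IsReebField [IsManifold 𝓘(ℝ, E) ∞ M] (η : DForm E M 1) (R : VField E M) : Prop where
  smooth : R.Smooth
  d_eq : ∀ (x : M) (v : TangentSpace 𝓘(ℝ, E) x), η.d x ![R x, v] = 0
  apply_eq : ∀ x, η x ![R x] = 1

/-- `X` is the contact Hamiltonian vector field of `h` with respect to `η`, where `R` is the Reeb
field of `η`: `i_X dη = dh - R(h) η` and `i_X η = -h`. -/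
structure IsContactHamiltonianField [IsManifold 𝓘(ℝ, E) ∞ M] (η : DForm E M 1) (R : VField E M) (h : M → ℝ)
    (X : VField E M) : Prop where
  smooth : X.Smooth
  d_eq : ∀ (x : M) (v : TangentSpace 𝓘(ℝ, E) x), η.d x ![X x, v] =
    dfun h x v - R.deriv h x * η x ![v]
  apply_eq : ∀ x, η x ![X x] = -h x

/-- `D` is a scaling symmetry of degree `Λ` of `(M, Ω, H)`: `L_D Ω = Ω` and `L_D H = Λ H`. -/
structure IsScalingSymmetry [IsManifold 𝓘(ℝ, E) ∞ M] (Ω : DForm E M 2) (H : M → ℝ) (D : VField E M) (Λ : ℝ) : Prop where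
  smooth : D.Smooth
  lieDeriv_form : ∀ x, DForm.lieDeriv D Ω x = Ω x
  deriv_hamiltonian : ∀ x, D.deriv H x = Λ * H x

/-- `ρ : M → ℝ \ {0}` is a global scaling function for `D`: `L_D ρ = ρ`. -/
structure IsScalingFunction (D : VField E M) (ρ : M → ℝ) : Prop where
  smooth : ContMDiff 𝓘(ℝ, E) 𝓘(ℝ, ℝ) ∞ ρ
  ne_zero : ∀ x, ρ x ≠ 0
  deriv_eq : ∀ x, D.deriv ρ x = ρ x

/-- Two points lie on a common integral curve of `D` (defined on some open interval). -/
def SameOrbit (D : VField E M) (x y : M) : Prop :=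
  ∃ (γ : ℝ → M) (a b : ℝ), IsMIntegralCurveOn γ D (Set.Ioo a b) ∧
    x ∈ γ '' Set.Ioo a b ∧ y ∈ γ '' Set.Ioo a b

end Systems

/-- The power `x ^ a` of a nonzero real number `x` for a real exponent `a`, with
`(-1) ^ a := ε` for a chosen sign `ε`. For positive `x` this is the usual power; for integer `a`
and `ε = (-1) ^ a` it is the usual integer power. -/
def signedPow (ε : ℤˣ) (a x : ℝ) : ℝ :=
  if 0 < x then x ^ a else ((ε : ℤ) : ℝ) * |x| ^ a

theorem signedPow_of_pos (ε : ℤˣ) (a : ℝ) {x : ℝ} (hx : 0 < x) : signedPow ε a x = x ^ a := by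
  simp [signedPow, hx]

theorem signedPow_intCast (a : ℤ) {x : ℝ} (hx : x ≠ 0) :
    signedPow ((-1) ^ a) a x = x ^ a := by
  unfold signedPow
  split_ifs with h
  · exact Real.rpow_intCast x a
  · have hx' : x < 0 := lt_of_le_of_ne (not_lt.mp h) hx
    rw [Real.rpow_intCast, abs_of_neg hx']
    rcases Int.even_or_odd a with ha | ha
    · rw [ha.neg_one_zpow, ha.neg_zpow]; simp
    · rw [ha.neg_one_zpow, ha.neg_zpow]; simp

/-! ### The reduction -/

section Reduction

variable {E : Type*} [NormedAddCommGroup E] [NormedSpace ℝ E]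
  {M : Type*} [TopologicalSpace M] [ChartedSpace E M]
  {F : Type*} [NormedAddCommGroup F] [NormedSpace ℝ F]
  {C : Type*} [TopologicalSpace C] [ChartedSpace F C]

/-- The manifold `C`, with projection `π`, is the quotient `M/D` of `M` by the orbits of `D`:
`π` is a surjective smooth submersion whose fibres are the orbits of `D`. -/
structure IsOrbitSpace (D : VField E M) (π : M → C) : Prop where
  submersion : Manifold.IsSubmersion 𝓘(ℝ, E) 𝓘(ℝ, F) ∞ π
  surjective : Function.Surjective π
  eq_iff : ∀ x y, π x = π y ↔ SameOrbit D x y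

/-- The image of the line `span(X m)` under the differential of `π` at `m`. -/
def pushLine (F : Type*) [NormedAddCommGroup F] [NormedSpace ℝ F] [ChartedSpace F C]
    (π : M → C) (X : VField E M) (m : M) : Submodule ℝ (TangentSpace 𝓘(ℝ, F) (π m)) :=
  (Submodule.span ℝ {X m}).map
    (mfderiv 𝓘(ℝ, E) 𝓘(ℝ, F) π m : TangentSpace 𝓘(ℝ, E) m →ₗ[ℝ] TangentSpace 𝓘(ℝ, F) (π m))

/-- `ℓ` is the line field `π_* span(X)`: at each point of `C` it is the image of the line spanned
by `X` at any point of the fibre. For surjective `π` there is at most one such `ℓ`. -/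
def IsPushforwardLineField (π : M → C) (X : VField E M)
    (l : ∀ c : C, Submodule ℝ (TangentSpace 𝓘(ℝ, F) c)) : Prop :=
  ∀ m, pushLine F π X m = l (π m)

/-- A 1-form `η`, a function `h`, and vector fields `R`, `V` on `C`. -/
structure ContactData (F : Type*) [NormedAddCommGroup F] [NormedSpace ℝ F]
    (C : Type*) [TopologicalSpace C] [ChartedSpace F C] where
  η : DForm F C 1
  h : C → ℝ
  R : VField F C
  V : VField F C

/-- `(η, h, R, V)` is the contact system on `C` given by the scaling function `ρ`: `η` is the
contact form with `π^*η = λ/ρ`, where `λ = i_D Ω`; `h` is the function with `π^*h = -H/ρ^Λ`; `R` is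
the Reeb field of `η`; and `V` is the contact Hamiltonian vector field of `h`. The sign `ε`
stands for `(-1) ^ Λ`. -/
structure IsContactReduction [IsManifold 𝓘(ℝ, E) ∞ M]
    [IsManifold 𝓘(ℝ, F) ∞ C] (Ω : DForm E M 2) (H : M → ℝ) (D : VField E M) (Λ : ℝ) (ε : ℤˣ)
    (π : M → C) (ρ : M → ℝ) (c : ContactData F C) : Prop where
  contact : IsContactForm c.η
  pullback_form : ∀ m, (c.η (π m)).compContinuousLinearMap (mfderiv 𝓘(ℝ, E) 𝓘(ℝ, F) π m) =
    (ρ m)⁻¹ • DForm.interior D Ω m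
  smooth_hamiltonian : ContMDiff 𝓘(ℝ, F) 𝓘(ℝ, ℝ) ∞ c.h
  pullback_hamiltonian : ∀ m, c.h (π m) = -H m / signedPow ε Λ (ρ m)
  reeb : IsReebField c.η c.R
  field : IsContactHamiltonianField c.η c.R c.h c.V

/-- The vector field `X = X_h + (1 - Λ) h R`. -/
def ContactData.reducedField (Λ : ℝ) (c : ContactData F C) : VField F C := fun x =>
  c.V x + ((1 - Λ) * c.h x) • c.R x

end Reduction

end ScalingReduction

end

/-! Closedness of `Ω` and Cartan's formula turn `L_D Ω = Ω` into `dλ = Ω`, so everything can be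
computed upstairs from `d(λ/ρ) = -ρ⁻² dρ ∧ λ + ρ⁻¹ Ω`.

Descent. Since `dρ(D) = ρ ≠ 0`, the field `D` has no zeros, and by dimension it spans `ker dπ`. The
form `λ/ρ` is basic: `λ(D) = 0`, and `i_D d(λ/ρ) = -ρ⁻¹λ + ρ⁻¹λ = 0`. A basic form is locally
constant along the fibres in a product chart of the submersion
(`DForm.Smooth.eventually_eq_of_basic`). Connectedness of the interval carries this along a whole
integral curve (`SameOrbit.rel_of_eventually`), so the form descends to some `η`. Smoothness
downstairs comes from local sections. The function `-H/ρ^Λ` descends because `D` kills it.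

Contact geometry. The vector `z` with `i_z Ω = -dρ` projects to the Reeb vector. If `dη(u, ·)`
vanishes on `ker η` and `η(u) = 0`, then for a lift of `u` the form `i_u Ω` is a multiple of `λ =
i_D Ω`, so the lift is a multiple of `D` and projects to zero.

The central identity (`IsContactReduction.reducedField_eq`) is `X ∘ π = ρ^(1-Λ) π_* X_H`. Vectors on
`C` are separated by `η` and `dη` together, so it is enough to evaluate both on the right side:
`λ(X_H) = dH(D) = ΛH` gives `η = -Λh`, and the formula for `d(λ/ρ)` gives `dη = dh - R(h)η`. Read
backwards, the identity yields the contact Hamiltonian field. Read forwards, it gives the line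
field, and dividing the identities for two scaling functions gives the last claim. Fields defined by
such equations are smooth because `dη + η ⊗ η` is an invertible bilinear form depending smoothly on
the point. -/

noncomputable section

open Set Filter
open scoped Topology

namespace ScalingReduction

/-! ### Pullback of forms and naturality of the exterior derivative -/

section PullbackCalculus

variable {E : Type*} [NormedAddCommGroup E] [NormedSpace ℝ E]
  {M : Type*} [TopologicalSpace M] [ChartedSpace E M]
  {G : Type*} [NormedAddCommGroup G] [NormedSpace ℝ G]
  {N : Type*} [TopologicalSpace N] [ChartedSpace G N]
  {G' : Type*} [NormedAddCommGroup G'] [NormedSpace ℝ G']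
  {N' : Type*} [TopologicalSpace N'] [ChartedSpace G' N']
  {V : Type*} [NormedAddCommGroup V] [NormedSpace ℝ V] {k : ℕ}

theorem contMDiffAt_extChartAt_symm_of_mem [IsManifold 𝓘(ℝ, E) ∞ M] {x₀ : M} {y : E}
    (hy : y ∈ (extChartAt 𝓘(ℝ, E) x₀).target) :
    ContMDiffAt 𝓘(ℝ, E) 𝓘(ℝ, E) ∞ (extChartAt 𝓘(ℝ, E) x₀).symm y :=
  (contMDiffOn_extChartAt_symm x₀).contMDiffAt ((isOpen_extChartAt_target x₀).mem_nhds hy)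

theorem contMDiffAt_extChartAt_of_mem [IsManifold 𝓘(ℝ, E) ∞ M] {x₀ x : M}
    (hx : x ∈ (extChartAt 𝓘(ℝ, E) x₀).source) :
    ContMDiffAt 𝓘(ℝ, E) 𝓘(ℝ, E) ∞ (extChartAt 𝓘(ℝ, E) x₀) x :=
  contMDiffAt_extChartAt' (by simpa using hx)

theorem mfderiv_extChartAt_mfderiv_symm [IsManifold 𝓘(ℝ, E) ∞ M] {x₀ : M} {y : E}
    (hy : y ∈ (extChartAt 𝓘(ℝ, E) x₀).target) (v : E) :
    (mfderiv 𝓘(ℝ, E) 𝓘(ℝ, E) (extChartAt 𝓘(ℝ, E) x₀) ((extChartAt 𝓘(ℝ, E) x₀).symm y)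
      (mfderiv 𝓘(ℝ, E) 𝓘(ℝ, E) (extChartAt 𝓘(ℝ, E) x₀).symm y v : E) : E) = v := by
  have h := mfderiv_extChartAt_comp_mfderivWithin_extChartAt_symm (I := 𝓘(ℝ, E)) hy
  simp only [modelWithCornersSelf_coe, range_id, mfderivWithin_univ] at h
  exact congrArg (fun L : E →L[ℝ] E => L v) h

theorem mfderiv_symm_mfderiv_extChartAt [IsManifold 𝓘(ℝ, E) ∞ M] {x₀ x : M}
    (hx : x ∈ (extChartAt 𝓘(ℝ, E) x₀).source) (v : E) :
    (mfderiv 𝓘(ℝ, E) 𝓘(ℝ, E) (extChartAt 𝓘(ℝ, E) x₀).symm (extChartAt 𝓘(ℝ, E) x₀ x)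
      (mfderiv 𝓘(ℝ, E) 𝓘(ℝ, E) (extChartAt 𝓘(ℝ, E) x₀) x v : E) : E) = v := by
  have h := mfderivWithin_extChartAt_symm_comp_mfderiv_extChartAt' (I := 𝓘(ℝ, E)) hx
  simp only [modelWithCornersSelf_coe, range_id, mfderivWithin_univ] at h
  exact congrArg (fun L : E →L[ℝ] E => L v) h

variable (G) in
/-- The pullback of a form under a map. -/
def DForm.pullback (α : DForm E M k) (g : N → M) : DForm G N k := fun x =>
  (α (g x)).compContinuousLinearMap (mfderiv 𝓘(ℝ, G) 𝓘(ℝ, E) g x)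

theorem DForm.inChart_eq_pullback (α : DForm E M k) (x₀ : M) :
    α.inChart x₀ = α.pullback E (extChartAt 𝓘(ℝ, E) x₀).symm := rfl

theorem DForm.pullback_congr (α : DForm E M k) {f g : N → M} {x : N} (h : f =ᶠ[𝓝 x] g) :
    α.pullback G f x = α.pullback G g x := by
  unfold DForm.pullback
  rw [h.mfderiv_eq, h.eq_of_nhds]

theorem DForm.pullback_pullback (α : DForm E M k) {f : N → M} {g : N' → N} {x : N'}
    (hf : MDifferentiableAt 𝓘(ℝ, G) 𝓘(ℝ, E) f (g x))
    (hg : MDifferentiableAt 𝓘(ℝ, G') 𝓘(ℝ, G) g x) :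
    (α.pullback G f).pullback G' g x = α.pullback G' (f ∘ g) x := by
  unfold DForm.pullback
  rw [mfderiv_comp x hf hg]
  rfl

/-- Near `x` the map `g` is the inverse chart composed with chart and `g`. This moves pullback
questions to forms on the model space. -/
theorem DForm.pullback_eq_inChart [IsManifold 𝓘(ℝ, E) ∞ M] (α : DForm E M k) {g : N → M} {x : N}
    {x₀ : M} (hg : MDifferentiableAt 𝓘(ℝ, G) 𝓘(ℝ, E) g x)
    (hx : g x ∈ (extChartAt 𝓘(ℝ, E) x₀).source) :
    α.pullback G g x = DForm.pullback G (M := E) (α.inChart x₀) (extChartAt 𝓘(ℝ, E) x₀ ∘ g) x := by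
  have h1 := (contMDiffAt_extChartAt_of_mem hx).mdifferentiableAt (by simp)
  have h2 := (contMDiffAt_extChartAt_symm_of_mem
    ((extChartAt 𝓘(ℝ, E) x₀).map_source hx)).mdifferentiableAt (by simp)
  rw [DForm.inChart_eq_pullback]
  refine Eq.trans ?_ (DForm.pullback_pullback α (g := extChartAt 𝓘(ℝ, E) x₀ ∘ g) h2
    (h1.comp x hg)).symm
  apply DForm.pullback_congr
  have : ∀ᶠ z in 𝓝 x, g z ∈ (extChartAt 𝓘(ℝ, E) x₀).source :=
    hg.continuousAt.eventually_mem ((isOpen_extChartAt_source x₀).mem_nhds hx)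
  filter_upwards [this] with z hz
  exact ((extChartAt 𝓘(ℝ, E) x₀).left_inv hz).symm

theorem DForm.Smooth.contDiffAt {α : DForm E M k} (hα : α.Smooth) {x₀ : M} {y : E}
    (hy : y ∈ (extChartAt 𝓘(ℝ, E) x₀).target) : ContDiffAt ℝ ∞ (α.inChart x₀) y :=
  (hα x₀).contDiffAt ((isOpen_extChartAt_target x₀).mem_nhds hy)

theorem eventually_mdifferentiableAt [IsManifold 𝓘(ℝ, E) ∞ M] [IsManifold 𝓘(ℝ, G) ∞ N]
    {g : N → M} {x : N}
    (hg : ContMDiffAt 𝓘(ℝ, G) 𝓘(ℝ, E) ∞ g x) :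
    ∀ᶠ z in 𝓝 x, MDifferentiableAt 𝓘(ℝ, G) 𝓘(ℝ, E) g z := by
  have h1 : ContMDiffAt 𝓘(ℝ, G) 𝓘(ℝ, E) 1 g x := hg.of_le (by simp)
  filter_upwards [(contMDiffAt_iff_contMDiffAt_nhds (by simp)).1 h1] with z hz
    using hz.mdifferentiableAt (by simp)

theorem DForm.pullback_eventuallyEq_inChart [IsManifold 𝓘(ℝ, E) ∞ M] (α : DForm E M k)
    {g : V → M} {y : V} {x₀ : M} (hg : ContMDiffAt 𝓘(ℝ, V) 𝓘(ℝ, E) ∞ g y)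
    (hx : g y ∈ (extChartAt 𝓘(ℝ, E) x₀).source) :
    (show V → V [⋀^Fin k]→L[ℝ] ℝ from α.pullback V g) =ᶠ[𝓝 y] fun z =>
      (α.inChart x₀ ((extChartAt 𝓘(ℝ, E) x₀ ∘ g) z)).compContinuousLinearMap
        (fderiv ℝ (extChartAt 𝓘(ℝ, E) x₀ ∘ g) z) := by
  filter_upwards [eventually_mdifferentiableAt hg,
    hg.continuousAt.eventually_mem ((isOpen_extChartAt_source x₀).mem_nhds hx)] with z h1 h2
  refine (α.pullback_eq_inChart h1 h2).trans ?_
  unfold DForm.pullback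
  rw [mfderiv_eq_fderiv]
  rfl

theorem contDiffAt_extChartAt_comp [IsManifold 𝓘(ℝ, E) ∞ M] {g : V → M} {y : V} {x₀ : M}
    (hg : ContMDiffAt 𝓘(ℝ, V) 𝓘(ℝ, E) ∞ g y) (hx : g y ∈ (extChartAt 𝓘(ℝ, E) x₀).source) :
    ContDiffAt ℝ ∞ (extChartAt 𝓘(ℝ, E) x₀ ∘ g) y :=
  contMDiffAt_iff_contDiffAt.1 ((contMDiffAt_extChartAt_of_mem hx).comp y hg)

theorem DForm.Smooth.extDeriv_pullback [IsManifold 𝓘(ℝ, E) ∞ M] {α : DForm E M k} (hα : α.Smooth)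
    {g : V → M} {y : V} (hg : ContMDiffAt 𝓘(ℝ, V) 𝓘(ℝ, E) ∞ g y) :
    extDeriv (E := V) (F := ℝ) (α.pullback V g) y = α.d.pullback V g y := by
  have hx : g y ∈ (extChartAt 𝓘(ℝ, E) (g y)).source := mem_extChartAt_source _
  rw [(α.pullback_eventuallyEq_inChart hg hx).extDeriv_eq]
  rw [_root_.extDeriv_pullback (f := extChartAt 𝓘(ℝ, E) (g y) ∘ g) (r := ∞)
    ((hα.contDiffAt ((extChartAt 𝓘(ℝ, E) (g y)).map_source hx)).differentiableAt (by simp))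
    (contDiffAt_extChartAt_comp hg hx)
    (by simpa using ENat.LEInfty.out)]
  have h1 := (contMDiffAt_extChartAt_of_mem hx).mdifferentiableAt (by simp)
  rw [← mfderiv_eq_fderiv, mfderiv_comp y h1 (hg.mdifferentiableAt (by simp))]
  rfl

/-- Naturality applied to an inverse chart. It shows that `d`, defined at each point through the
chart centred there, may be computed in any chart. -/
theorem DForm.Smooth.d_inChart [IsManifold 𝓘(ℝ, E) ∞ M] {α : DForm E M k} (hα : α.Smooth)
    {x₀ : M} {y : E} (hy : y ∈ (extChartAt 𝓘(ℝ, E) x₀).target) :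
    α.d.inChart x₀ y = extDeriv (α.inChart x₀) y :=
  (hα.extDeriv_pullback (contMDiffAt_extChartAt_symm_of_mem hy)).symm

theorem DForm.pullback_inChart_eventuallyEq [IsManifold 𝓘(ℝ, E) ∞ M] [IsManifold 𝓘(ℝ, G) ∞ N]
    (α : DForm E M k) {f : N → M} {x₀ x : N} (hf : ContMDiffAt 𝓘(ℝ, G) 𝓘(ℝ, E) ∞ f x)
    (hx : x ∈ (extChartAt 𝓘(ℝ, G) x₀).source) :
    (α.pullback G f).inChart x₀ =ᶠ[𝓝 (extChartAt 𝓘(ℝ, G) x₀ x)]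
      (α.pullback G (f ∘ (extChartAt 𝓘(ℝ, G) x₀).symm) : G → G [⋀^Fin k]→L[ℝ] ℝ) := by
  have hy := (extChartAt 𝓘(ℝ, G) x₀).map_source hx
  have hc : Tendsto (extChartAt 𝓘(ℝ, G) x₀).symm (𝓝 (extChartAt 𝓘(ℝ, G) x₀ x)) (𝓝 x) := by
    have := (contMDiffAt_extChartAt_symm_of_mem hy).continuousAt
    rwa [ContinuousAt, (extChartAt 𝓘(ℝ, G) x₀).left_inv hx] at this
  filter_upwards [hc.eventually (eventually_mdifferentiableAt hf),
    (isOpen_extChartAt_target x₀).mem_nhds hy] with z h1 h2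
  exact α.pullback_pullback h1
    ((contMDiffAt_extChartAt_symm_of_mem h2).mdifferentiableAt (by simp))

theorem DForm.inChart_congr {α β : DForm E M k} [IsManifold 𝓘(ℝ, E) ∞ M] {x₀ x : M}
    (hx : x ∈ (extChartAt 𝓘(ℝ, E) x₀).source) (h : ∀ᶠ z in 𝓝 x, α z = β z) :
    α.inChart x₀ =ᶠ[𝓝 (extChartAt 𝓘(ℝ, E) x₀ x)] β.inChart x₀ := by
  have hy := (extChartAt 𝓘(ℝ, E) x₀).map_source hx
  have hc : Tendsto (extChartAt 𝓘(ℝ, E) x₀).symm (𝓝 (extChartAt 𝓘(ℝ, E) x₀ x)) (𝓝 x) := by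
    have := (contMDiffAt_extChartAt_symm_of_mem hy).continuousAt
    rwa [ContinuousAt, (extChartAt 𝓘(ℝ, E) x₀).left_inv hx] at this
  filter_upwards [hc.eventually h] with z hz
  unfold DForm.inChart
  rw [hz]

/-- Naturality on manifolds follows from the case of a vector space as source, applied to `f`
composed with the inverse chart at `x`. The chart then cancels against its inverse. -/
theorem DForm.Smooth.d_pullback [IsManifold 𝓘(ℝ, E) ∞ M] [IsManifold 𝓘(ℝ, G) ∞ N]
    {α : DForm E M k} (hα : α.Smooth) {f : N → M} {x : N}
    (hf : ContMDiffAt 𝓘(ℝ, G) 𝓘(ℝ, E) ∞ f x) :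
    (α.pullback G f).d x = α.d.pullback G f x := by
  have hx : x ∈ (extChartAt 𝓘(ℝ, G) x).source := mem_extChartAt_source _
  have hy := (extChartAt 𝓘(ℝ, G) x).map_source hx
  have hs := contMDiffAt_extChartAt_symm_of_mem hy
  have he := (extChartAt 𝓘(ℝ, G) x).left_inv hx
  have hf' : ContMDiffAt 𝓘(ℝ, G) 𝓘(ℝ, E) ∞ (f ∘ (extChartAt 𝓘(ℝ, G) x).symm)
      (extChartAt 𝓘(ℝ, G) x x) := ContMDiffAt.comp _ (by rwa [he]) hs
  unfold DForm.d
  rw [(α.pullback_inChart_eventuallyEq hf hx).extDeriv_eq, hα.extDeriv_pullback hf']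
  have h1 := (contMDiffAt_extChartAt_of_mem hx).mdifferentiableAt (by simp)
  refine (α.d.pullback_pullback (hf'.mdifferentiableAt (by simp)) h1).trans ?_
  apply DForm.pullback_congr
  filter_upwards [(isOpen_extChartAt_source x).mem_nhds hx] with z hz
  exact congrArg f ((extChartAt 𝓘(ℝ, G) x).left_inv hz)

/-- In degree one an alternating map is a linear map, so this is smoothness of composition of linear
maps. -/
theorem contDiffAt_compContinuousLinearMap_one {θ : V → E [⋀^Fin 1]→L[ℝ] ℝ} {L : V → G →L[ℝ] E}
    {y : V} (hθ : ContDiffAt ℝ ∞ θ y) (hL : ContDiffAt ℝ ∞ L y) :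
    ContDiffAt ℝ ∞ (fun z => (θ z).compContinuousLinearMap (L z)) y := by
  let e := ContinuousAlternatingMap.ofSubsingletonLIE (𝕜 := ℝ) (E := E) (F := ℝ) (0 : Fin 1)
  let e' := ContinuousAlternatingMap.ofSubsingletonLIE (𝕜 := ℝ) (E := G) (F := ℝ) (0 : Fin 1)
  have h : ContDiffAt ℝ ∞ (fun z => e' ((e.symm (θ z)).comp (L z))) y :=
    e'.toContinuousLinearEquiv.contDiff.contDiffAt.comp y
      ((e.symm.toContinuousLinearEquiv.contDiff.contDiffAt.comp y hθ).clm_comp hL)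
  refine h.congr_of_eventuallyEq (Eventually.of_forall fun z => ?_)
  ext v
  change θ z (fun i => L z (v i)) = θ z _
  congr 1
  ext i
  rw [Subsingleton.elim i 0]
  rfl

theorem DForm.Smooth.contDiffAt_pullback [IsManifold 𝓘(ℝ, E) ∞ M] {α : DForm E M 1}
    (hα : α.Smooth) {g : V → M} {y : V} (hg : ContMDiffAt 𝓘(ℝ, V) 𝓘(ℝ, E) ∞ g y) :
    ContDiffAt ℝ ∞ (F := V [⋀^Fin 1]→L[ℝ] ℝ) (α.pullback V g) y := by
  have hx : g y ∈ (extChartAt 𝓘(ℝ, E) (g y)).source := mem_extChartAt_source _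
  have hc := contDiffAt_extChartAt_comp hg hx
  refine ContDiffAt.congr_of_eventuallyEq ?_ (α.pullback_eventuallyEq_inChart hg hx)
  refine contDiffAt_compContinuousLinearMap_one
    (ContDiffAt.comp y (hα.contDiffAt ((extChartAt 𝓘(ℝ, E) (g y)).map_source hx)) hc) ?_
  exact hc.fderiv_right (m := ∞) (by simp)

/-- The map `f` may change from point to point and need only be smooth at that point; local sections
of a submersion are of this kind. -/
theorem DForm.smooth_of_eventuallyEq_pullback [IsManifold 𝓘(ℝ, E) ∞ M] [IsManifold 𝓘(ℝ, G) ∞ N]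
    {α : DForm E M 1} (hα : α.Smooth) {β : DForm G N 1}
    (h : ∀ x, ∃ f : N → M, ContMDiffAt 𝓘(ℝ, G) 𝓘(ℝ, E) ∞ f x ∧
      ∀ᶠ z in 𝓝 x, β z = α.pullback G f z) : β.Smooth := by
  intro x₀ y hy
  obtain ⟨f, hf, hβ⟩ := h ((extChartAt 𝓘(ℝ, G) x₀).symm y)
  have hx := (extChartAt 𝓘(ℝ, G) x₀).map_target hy
  have hr := (extChartAt 𝓘(ℝ, G) x₀).right_inv hy
  apply ContDiffAt.contDiffWithinAt
  have h1 := (DForm.inChart_congr hx hβ).trans (α.pullback_inChart_eventuallyEq hf hx)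
  rw [hr] at h1
  refine ContDiffAt.congr_of_eventuallyEq ?_ h1
  exact hα.contDiffAt_pullback (hf.comp y (contMDiffAt_extChartAt_symm_of_mem hy))

end PullbackCalculus

/-! ### Functions, vector fields and the Leibniz rule in charts -/

section Fields

variable {E : Type*} [NormedAddCommGroup E] [NormedSpace ℝ E]
  {M : Type*} [TopologicalSpace M] [ChartedSpace E M]
  {G : Type*} [NormedAddCommGroup G] [NormedSpace ℝ G]
  {N : Type*} [TopologicalSpace N] [ChartedSpace G N] {k : ℕ}

theorem dfun_comp {f : M → ℝ} {g : N → M} {x : N}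
    (hf : MDifferentiableAt 𝓘(ℝ, E) 𝓘(ℝ, ℝ) f (g x))
    (hg : MDifferentiableAt 𝓘(ℝ, G) 𝓘(ℝ, E) g x) (v : TangentSpace 𝓘(ℝ, G) x) :
    dfun (f ∘ g) x v = dfun f (g x) (mfderiv 𝓘(ℝ, G) 𝓘(ℝ, E) g x v) := by
  unfold dfun
  rw [mfderiv_comp x hf hg]
  rfl

theorem dfun_comp_real {f : M → ℝ} {g : ℝ → ℝ} {x : M} {g' : ℝ} (hg : HasDerivAt g g' (f x))
    (hf : MDifferentiableAt 𝓘(ℝ, E) 𝓘(ℝ, ℝ) f x) (v : TangentSpace 𝓘(ℝ, E) x) :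
    dfun (fun z => g (f z)) x v = g' * dfun f x v := by
  have h := (hg.hasFDerivAt.hasMFDerivAt.comp x hf.hasMFDerivAt).mfderiv
  unfold dfun
  change (mfderiv 𝓘(ℝ, E) 𝓘(ℝ, ℝ) (g ∘ f) x v : ℝ) = _
  rw [h]
  exact mul_comm (dfun f x v) g'

theorem dfun_mul {f g : M → ℝ} {x : M} (hf : MDifferentiableAt 𝓘(ℝ, E) 𝓘(ℝ, ℝ) f x)
    (hg : MDifferentiableAt 𝓘(ℝ, E) 𝓘(ℝ, ℝ) g x) (v : TangentSpace 𝓘(ℝ, E) x) :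
    dfun (fun z => f z * g z) x v = f x * dfun g x v + g x * dfun f x v := by
  have h := (hf.hasMFDerivAt.mul hg.hasMFDerivAt).mfderiv
  unfold dfun
  change (mfderiv 𝓘(ℝ, E) 𝓘(ℝ, ℝ) (f * g) x v : ℝ) = _
  rw [h]
  rfl

theorem contDiffAt_comp_extChartAt_symm [IsManifold 𝓘(ℝ, E) ∞ M] {f : M → ℝ}
    (hf : ContMDiff 𝓘(ℝ, E) 𝓘(ℝ, ℝ) ∞ f) {x₀ : M} {y : E}
    (hy : y ∈ (extChartAt 𝓘(ℝ, E) x₀).target) :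
    ContDiffAt ℝ ∞ (fun z => f ((extChartAt 𝓘(ℝ, E) x₀).symm z)) y :=
  contMDiffAt_iff_contDiffAt.1
    ((hf _).comp y (contMDiffAt_extChartAt_symm_of_mem hy))

theorem contMDiff_of_contDiffAt_extChartAt_symm [IsManifold 𝓘(ℝ, E) ∞ M] {f : M → ℝ}
    (hf : ∀ (x₀ : M) (y : E), y ∈ (extChartAt 𝓘(ℝ, E) x₀).target →
      ContDiffAt ℝ ∞ (fun z => f ((extChartAt 𝓘(ℝ, E) x₀).symm z)) y) :
    ContMDiff 𝓘(ℝ, E) 𝓘(ℝ, ℝ) ∞ f := by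
  intro x
  have hx : x ∈ (extChartAt 𝓘(ℝ, E) x).source := mem_extChartAt_source _
  have h := (contMDiffAt_iff_contDiffAt.2
    (hf x _ ((extChartAt 𝓘(ℝ, E) x).map_source hx))).comp x (contMDiffAt_extChartAt_of_mem hx)
  refine h.congr_of_eventuallyEq ?_
  filter_upwards [(isOpen_extChartAt_source x).mem_nhds hx] with z hz
  exact congrArg f ((extChartAt 𝓘(ℝ, E) x).left_inv hz).symm

/-- The expression of a vector field in the preferred chart at `x₀`. -/
def VField.inChart (X : VField E M) (x₀ : M) (y : E) : E :=
  mfderiv 𝓘(ℝ, E) 𝓘(ℝ, E) (extChartAt 𝓘(ℝ, E) x₀) ((extChartAt 𝓘(ℝ, E) x₀).symm y)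
    (X ((extChartAt 𝓘(ℝ, E) x₀).symm y))

theorem VField.mfderiv_symm_inChart [IsManifold 𝓘(ℝ, E) ∞ M] (X : VField E M) {x₀ : M} {y : E}
    (hy : y ∈ (extChartAt 𝓘(ℝ, E) x₀).target) :
    (mfderiv 𝓘(ℝ, E) 𝓘(ℝ, E) (extChartAt 𝓘(ℝ, E) x₀).symm y (X.inChart x₀ y) : E) =
      X ((extChartAt 𝓘(ℝ, E) x₀).symm y) := by
  have h := mfderiv_symm_mfderiv_extChartAt ((extChartAt 𝓘(ℝ, E) x₀).map_target hy)
    (X ((extChartAt 𝓘(ℝ, E) x₀).symm y))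
  rw [(extChartAt 𝓘(ℝ, E) x₀).right_inv hy] at h
  exact h

/-- The trivialization of the tangent bundle at `x₀` is the differential of the chart at `x₀`, so
smoothness of a section can be read off from its chart expression. -/
theorem VField.smooth_iff_inChart [IsManifold 𝓘(ℝ, E) ∞ M] (X : VField E M) :
    X.Smooth ↔ ∀ x₀, ContDiffOn ℝ ∞ (X.inChart x₀) (extChartAt 𝓘(ℝ, E) x₀).target := by
  have key : ∀ x₀ x, x ∈ (extChartAt 𝓘(ℝ, E) x₀).source →
      (ContMDiffAt 𝓘(ℝ, E) 𝓘(ℝ, E).tangent ∞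
        (fun x => (⟨x, X x⟩ : TangentBundle 𝓘(ℝ, E) M)) x ↔
      ContMDiffAt 𝓘(ℝ, E) 𝓘(ℝ, E) ∞ (fun z =>
        (mfderiv 𝓘(ℝ, E) 𝓘(ℝ, E) (extChartAt 𝓘(ℝ, E) x₀) z (X z) : E)) x) := by
    intro x₀ x hx
    have hx' : x ∈ (trivializationAt E (TangentSpace 𝓘(ℝ, E)) x₀).baseSet := by
      simpa using hx
    refine ((trivializationAt E (TangentSpace 𝓘(ℝ, E)) x₀).contMDiffAt_section_iff
      (IB := 𝓘(ℝ, E)) (n := ∞) (s := X) hx').trans ?_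
    apply Filter.EventuallyEq.contMDiffAt_iff
    filter_upwards [(trivializationAt E (TangentSpace 𝓘(ℝ, E)) x₀).open_baseSet.mem_nhds hx']
      with z hz
    have hz' : z ∈ (chartAt E x₀).source := by simpa using hz
    rw [← TangentBundle.continuousLinearMapAt_trivializationAt hz']
    exact ((trivializationAt E (TangentSpace 𝓘(ℝ, E)) x₀).continuousLinearMapAt_apply_of_mem
      ℝ hz (X z)).symm
  constructor
  · intro h x₀ y hy
    have hx := (extChartAt 𝓘(ℝ, E) x₀).map_target hy
    exact (contMDiffAt_iff_contDiffAt.1 (((key x₀ _ hx).1 (h _)).comp y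
      (contMDiffAt_extChartAt_symm_of_mem hy))).contDiffWithinAt
  · intro h x
    have hx : x ∈ (extChartAt 𝓘(ℝ, E) x).source := mem_extChartAt_source _
    have hy := (extChartAt 𝓘(ℝ, E) x).map_source hx
    refine (key x x hx).2 ?_
    refine ((contMDiffAt_iff_contDiffAt.2 ((h x).contDiffAt
      ((isOpen_extChartAt_target x).mem_nhds hy))).comp x
      (contMDiffAt_extChartAt_of_mem hx)).congr_of_eventuallyEq ?_
    filter_upwards [(isOpen_extChartAt_source x).mem_nhds hx] with z hz
    simp only [Function.comp_apply, VField.inChart]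
    rw [(extChartAt 𝓘(ℝ, E) x).left_inv hz]

theorem VField.Smooth.contDiffAt [IsManifold 𝓘(ℝ, E) ∞ M] {X : VField E M} (hX : X.Smooth)
    {x₀ : M} {y : E} (hy : y ∈ (extChartAt 𝓘(ℝ, E) x₀).target) :
    ContDiffAt ℝ ∞ (X.inChart x₀) y :=
  ((X.smooth_iff_inChart.1 hX) x₀).contDiffAt ((isOpen_extChartAt_target x₀).mem_nhds hy)

theorem contDiff_curryLeft : ContDiff ℝ ∞
    (fun θ : E [⋀^Fin (k + 1)]→L[ℝ] ℝ => ContinuousAlternatingMap.curryLeft θ) := by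
  apply IsBoundedLinearMap.contDiff
  refine IsLinearMap.with_bound ⟨fun _ _ => rfl, fun _ _ => rfl⟩ 1 fun θ => ?_
  rw [ContinuousAlternatingMap.norm_curryLeft, one_mul]

theorem DForm.Smooth.interior [IsManifold 𝓘(ℝ, E) ∞ M] {α : DForm E M (k + 1)} (hα : α.Smooth)
    {X : VField E M} (hX : X.Smooth) : (DForm.interior X α).Smooth := by
  intro x₀ y hy
  apply ContDiffAt.contDiffWithinAt
  have h : ContDiffAt ℝ ∞
      (fun z => ContinuousAlternatingMap.curryLeft (α.inChart x₀ z) (X.inChart x₀ z)) y :=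
    ContDiffAt.clm_apply
      (contDiff_curryLeft.contDiffAt.comp y (hα.contDiffAt hy)) (hX.contDiffAt hy)
  refine h.congr_of_eventuallyEq ?_
  filter_upwards [(isOpen_extChartAt_target x₀).mem_nhds hy] with z hz
  ext v
  have e := X.mfderiv_symm_inChart hz
  change α _ (Matrix.vecCons (X ((extChartAt 𝓘(ℝ, E) x₀).symm z)) _) = α _ _
  congr 1
  ext i
  refine Fin.cases ?_ (fun j => ?_) i
  · exact e.symm
  · rfl

theorem VField.deriv_comp_symm [IsManifold 𝓘(ℝ, E) ∞ M] (X : VField E M) {f : M → ℝ}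
    (hf : ContMDiff 𝓘(ℝ, E) 𝓘(ℝ, ℝ) ∞ f) {x₀ : M} {y : E}
    (hy : y ∈ (extChartAt 𝓘(ℝ, E) x₀).target) :
    X.deriv f ((extChartAt 𝓘(ℝ, E) x₀).symm y) =
      fderiv ℝ (fun z => f ((extChartAt 𝓘(ℝ, E) x₀).symm z)) y (X.inChart x₀ y) := by
  have h := dfun_comp ((hf _).mdifferentiableAt (by simp))
    ((contMDiffAt_extChartAt_symm_of_mem hy).mdifferentiableAt (by simp)) (X.inChart x₀ y)
  unfold VField.deriv
  rw [← X.mfderiv_symm_inChart hy]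
  refine h.symm.trans ?_
  unfold dfun
  rw [mfderiv_eq_fderiv]
  rfl

theorem VField.Smooth.contMDiff_deriv [IsManifold 𝓘(ℝ, E) ∞ M] {X : VField E M} (hX : X.Smooth)
    {f : M → ℝ} (hf : ContMDiff 𝓘(ℝ, E) 𝓘(ℝ, ℝ) ∞ f) :
    ContMDiff 𝓘(ℝ, E) 𝓘(ℝ, ℝ) ∞ (X.deriv f) := by
  apply contMDiff_of_contDiffAt_extChartAt_symm
  intro x₀ y hy
  have h : ContDiffAt ℝ ∞ (fun z => fderiv ℝ (fun z => f ((extChartAt 𝓘(ℝ, E) x₀).symm z)) z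
      (X.inChart x₀ z)) y :=
    ((contDiffAt_comp_extChartAt_symm hf hy).fderiv_right (m := ∞) (by simp)).clm_apply
      (hX.contDiffAt hy)
  refine h.congr_of_eventuallyEq ?_
  filter_upwards [(isOpen_extChartAt_target x₀).mem_nhds hy] with z hz
  exact X.deriv_comp_symm hf hz

theorem DForm.Smooth.smul [IsManifold 𝓘(ℝ, E) ∞ M] {α : DForm E M k} (hα : α.Smooth)
    {f : M → ℝ} (hf : ContMDiff 𝓘(ℝ, E) 𝓘(ℝ, ℝ) ∞ f) :
    DForm.Smooth (fun x => f x • α x) := by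
  intro x₀ y hy
  exact ((contDiffAt_comp_extChartAt_symm hf hy).smul (hα.contDiffAt hy)).contDiffWithinAt

theorem extDeriv_one_apply (θ : E → E [⋀^Fin 1]→L[ℝ] ℝ) (y a b : E) :
    extDeriv θ y ![a, b] = fderiv ℝ θ y a ![b] - fderiv ℝ θ y b ![a] := by
  rw [extDeriv, ContinuousAlternatingMap.alternatizeUncurryFin_apply, Fin.sum_univ_two]
  simp only [Fin.val_zero, pow_zero, one_smul, Fin.val_one, pow_one, neg_smul, sub_eq_add_neg]
  congr 3
  ext i
  fin_cases i
  rfl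

/-- The Leibniz rule `d(fα) = df ∧ α + f dα`, computed in the chart centred at `x`, where `L` is the
differential of that chart. -/
theorem DForm.d_smul_apply [IsManifold 𝓘(ℝ, E) ∞ M] {α : DForm E M 1} (hα : α.Smooth)
    {f : M → ℝ} (hf : ContMDiff 𝓘(ℝ, E) 𝓘(ℝ, ℝ) ∞ f) (x : M) (u v : TangentSpace 𝓘(ℝ, E) x) :
    DForm.d (fun x => f x • α x) x ![u, v] =
      dfun f x u * α x ![v] - dfun f x v * α x ![u] + f x * α.d x ![u, v] := by
  set φ := extChartAt 𝓘(ℝ, E) x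
  have hx : x ∈ φ.source := mem_extChartAt_source _
  have hy := φ.map_source hx
  have he := φ.left_inv hx
  have hcf := (contDiffAt_comp_extChartAt_symm hf hy).differentiableAt (by simp)
  have hcα := (hα.contDiffAt hy).differentiableAt (by simp)
  obtain ⟨L, hL⟩ : ∃ L : E →L[ℝ] E, L = mfderiv 𝓘(ℝ, E) 𝓘(ℝ, E) φ x := ⟨_, rfl⟩
  have hcons : ∀ (β : DForm E M 1) (u v : E),
      (β.d x : (Fin 2 → E) → ℝ) ![u, v] = extDeriv (β.inChart x) (φ x) ![L u, L v] := by
    intro β u v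
    change extDeriv (β.inChart x) (φ x) _ = _
    congr 1
    rw [hL]
    ext i
    fin_cases i <;> rfl
  have hdf : ∀ w : E, fderiv ℝ (fun z => f (φ.symm z)) (φ x) (L w) = dfun f x w := by
    intro w
    have h1 := VField.deriv_comp_symm (fun z => (w : E)) hf hy
    rw [he] at h1
    refine Eq.trans ?_ h1.symm
    congr 1
    unfold VField.inChart
    rw [he, hL]
    rfl
  have hαv : ∀ w : E, α.inChart x (φ x) ![L w] = (α x : (Fin 1 → E) → ℝ) ![w] := by
    intro w
    have h2 : (fun i => (mfderiv 𝓘(ℝ, E) 𝓘(ℝ, E) φ.symm (φ x)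
        ((![L w] : Fin 1 → E) i) : E)) = ![w] := by
      ext i
      fin_cases i
      rw [hL]
      exact mfderiv_symm_mfderiv_extChartAt hx w
    refine (congrArg (α (φ.symm (φ x)) : (Fin 1 → E) → ℝ) h2).trans ?_
    rw [he]
    rfl
  have hin : DForm.inChart (fun x => f x • α x) x =
      fun z => f (φ.symm z) • α.inChart x z := rfl
  refine (hcons _ u v).trans ?_
  have h4 := hcons α u v
  have h5 := hαv u
  have h6 := hαv v
  have h7 := hdf u
  have h8 := hdf v
  refine Eq.trans ?_ (congrArg₂ (· + ·) (congrArg₂ (· - ·) (congrArg₂ (· * ·) h7 h6)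
    (congrArg₂ (· * ·) h8 h5)) (congrArg (f x * ·) h4.symm))
  rw [extDeriv_one_apply, extDeriv_one_apply, hin, fderiv_fun_smul hcf hcα]
  simp only [add_apply, smul_apply, ContinuousLinearMap.smulRight_apply,
    ContinuousAlternatingMap.add_apply,
    ContinuousAlternatingMap.smul_apply, smul_eq_mul]
  rw [he]
  ring

end Fields

/-! ### Submersions: product charts, local sections, basic forms -/

section Submersions

universe u
variable {E : Type u} [NormedAddCommGroup E] [NormedSpace ℝ E]
  {M : Type*} [TopologicalSpace M] [ChartedSpace E M]
  {F : Type*} [NormedAddCommGroup F] [NormedSpace ℝ F]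
  {C : Type*} [TopologicalSpace C] [ChartedSpace F C] {π : M → C}

variable (E F) in
/-- The differential of a map, as a linear map between the model spaces. -/
def tderiv (f : M → C) (x : M) : E →L[ℝ] F := mfderiv 𝓘(ℝ, E) 𝓘(ℝ, F) f x

/-- The value of a form at a point, as an alternating map on the model space. -/
def DForm.toModel {k : ℕ} (α : DForm E M k) (x : M) : E [⋀^Fin k]→L[ℝ] ℝ := α x

/-- The value of a vector field at a point, as a vector of the model space. -/
def VField.toModel (X : VField E M) (x : M) : E := X x

theorem tderiv_comp {G : Type*} [NormedAddCommGroup G] [NormedSpace ℝ G]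
    {N : Type*} [TopologicalSpace N] [ChartedSpace G N] {f : M → C} {g : N → M} {x : N}
    (hf : MDifferentiableAt 𝓘(ℝ, E) 𝓘(ℝ, F) f (g x))
    (hg : MDifferentiableAt 𝓘(ℝ, G) 𝓘(ℝ, E) g x) :
    tderiv G F (f ∘ g) x = (tderiv E F f (g x)).comp (tderiv G E g x) :=
  mfderiv_comp x hf hg

theorem tderiv_congr {f g : M → C} {x : M} (h : f =ᶠ[𝓝 x] g) :
    tderiv E F f x = tderiv E F g x :=
  h.mfderiv_eq

theorem tderiv_id (x : M) : tderiv E E (id : M → M) x = ContinuousLinearMap.id ℝ E :=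
  mfderiv_id

theorem tderiv_eq_fderiv (f : E → F) (x : E) : tderiv E F f x = fderiv ℝ f x :=
  mfderiv_eq_fderiv

/-- The normal form of a submersion, with the splitting of `E` absorbed into the domain chart so
that `π` reads as the projection `F × K → F`. -/
theorem exists_product_chart [IsManifold 𝓘(ℝ, E) ∞ M] [IsManifold 𝓘(ℝ, F) ∞ C]
    (hπ : Manifold.IsSubmersion 𝓘(ℝ, E) 𝓘(ℝ, F) ∞ π) (m₀ : M) :
    ∃ (K : Type u) (_ : NormedAddCommGroup K) (_ : NormedSpace ℝ K)
      (e : OpenPartialHomeomorph M (F × K)) (ψ : OpenPartialHomeomorph C F),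
      m₀ ∈ e.source ∧ ContMDiffOn 𝓘(ℝ, E) 𝓘(ℝ, F × K) ∞ e e.source ∧
      ContMDiffOn 𝓘(ℝ, F × K) 𝓘(ℝ, E) ∞ e.symm e.target ∧
      ContMDiffOn 𝓘(ℝ, F) 𝓘(ℝ, F) ∞ ψ ψ.source ∧
      ContMDiffOn 𝓘(ℝ, F) 𝓘(ℝ, F) ∞ ψ.symm ψ.target ∧
      ∀ m ∈ e.source, π m ∈ ψ.source ∧ ψ (π m) = (e m).1 := by
  have h := hπ.isSubmersionAt m₀
  have he1 := contMDiffOn_of_mem_maximalAtlas h.domChart_mem_maximalAtlas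
  have he2 := contMDiffOn_symm_of_mem_maximalAtlas h.domChart_mem_maximalAtlas
  have hψ1 := contMDiffOn_of_mem_maximalAtlas h.codChart_mem_maximalAtlas
  have hψ2 := contMDiffOn_symm_of_mem_maximalAtlas h.codChart_mem_maximalAtlas
  refine ⟨h.complement, inferInstance, inferInstance,
    h.domChart.transHomeomorph h.equiv.toHomeomorph, h.codChart, h.mem_domChart_source,
    ?_, ?_, hψ1, hψ2, fun m hm => ⟨h.source_subset_preimage_source hm, ?_⟩⟩
  · exact h.equiv.contDiff.contMDiff.comp_contMDiffOn he1
  · exact he2.comp h.equiv.symm.contDiff.contMDiff.contMDiffOn fun _ hz => hz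
  · have hm' : m ∈ h.domChart.source := hm
    have hmt : h.domChart m ∈ (h.domChart.extend 𝓘(ℝ, E)).target := by
      simpa using h.domChart.map_source hm'
    have := h.writtenInCharts hmt
    simpa [h.domChart.left_inv hm'] using this

/-- A submersion has a smooth local section through every point. -/
theorem exists_local_section [IsManifold 𝓘(ℝ, E) ∞ M] [IsManifold 𝓘(ℝ, F) ∞ C]
    (hπ : Manifold.IsSubmersion 𝓘(ℝ, E) 𝓘(ℝ, F) ∞ π) (m₀ : M) :
    ∃ s : C → M, ContMDiffAt 𝓘(ℝ, F) 𝓘(ℝ, E) ∞ s (π m₀) ∧ s (π m₀) = m₀ ∧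
      ∀ᶠ c in 𝓝 (π m₀), π (s c) = c := by
  obtain ⟨K, _, _, e, ψ, hm, he1, he2, hψ1, hψ2, h⟩ := exists_product_chart hπ m₀
  obtain ⟨hc, hψ⟩ := h m₀ hm
  have hψ0 : (ψ (π m₀), (e m₀).2) = e m₀ := by rw [hψ]
  have hs1 : ContMDiffAt 𝓘(ℝ, F) 𝓘(ℝ, F) ∞ ψ (π m₀) :=
    hψ1.contMDiffAt (ψ.open_source.mem_nhds hc)
  have hs2 : ContMDiffAt 𝓘(ℝ, F) 𝓘(ℝ, F × K) ∞ (fun c => (ψ c, (e m₀).2)) (π m₀) :=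
    hs1.prodMk_space contMDiffAt_const
  have he : ContMDiffAt 𝓘(ℝ, F × K) 𝓘(ℝ, E) ∞ e.symm (ψ (π m₀), (e m₀).2) := by
    rw [hψ0]
    exact he2.contMDiffAt (e.open_target.mem_nhds (e.map_source hm))
  -- The section freezes the fibre coordinate at its value at `m₀`.
  refine ⟨fun c => e.symm (ψ c, (e m₀).2), he.comp (π m₀) hs2, ?_, ?_⟩
  · change e.symm (ψ (π m₀), (e m₀).2) = m₀
    rw [hψ0, e.left_inv hm]
  · have ht : ∀ᶠ c in 𝓝 (π m₀), (ψ c, (e m₀).2) ∈ e.target := by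
      apply hs2.continuousAt.eventually_mem
      rw [hψ0]
      exact e.open_target.mem_nhds (e.map_source hm)
    filter_upwards [ht, ψ.open_source.mem_nhds hc] with c h1 h2
    obtain ⟨h3, h4⟩ := h _ (e.map_target h1)
    rw [e.right_inv h1] at h4
    exact ψ.injOn h3 h2 h4

/-- Differentiate `π ∘ s = id` for a local section `s`. -/
theorem exists_rightInverse_tderiv [IsManifold 𝓘(ℝ, E) ∞ M] [IsManifold 𝓘(ℝ, F) ∞ C]
    (hπ : Manifold.IsSubmersion 𝓘(ℝ, E) 𝓘(ℝ, F) ∞ π) (m : M) :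
    ∃ L : F →L[ℝ] E, ∀ w, tderiv E F π m (L w) = w := by
  obtain ⟨s, hs, hsm, hπs⟩ := exists_local_section hπ m
  refine ⟨tderiv F E s (π m), fun w => ?_⟩
  have h2 : π ∘ s =ᶠ[𝓝 (π m)] id := hπs
  have h1 := tderiv_congr (E := F) (F := F) h2
  rw [tderiv_comp ((hπ.contMDiff _).mdifferentiableAt (by simp))
    (hs.mdifferentiableAt (by simp)), tderiv_id, hsm] at h1
  exact congrArg (fun L : F →L[ℝ] F => L w) h1

theorem contMDiff_of_comp_isSubmersion [IsManifold 𝓘(ℝ, E) ∞ M] [IsManifold 𝓘(ℝ, F) ∞ C]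
    (hπ : Manifold.IsSubmersion 𝓘(ℝ, E) 𝓘(ℝ, F) ∞ π) (hs : Function.Surjective π)
    {f : M → ℝ} (hf : ContMDiff 𝓘(ℝ, E) 𝓘(ℝ, ℝ) ∞ f) {g : C → ℝ} (hg : ∀ m, g (π m) = f m) :
    ContMDiff 𝓘(ℝ, F) 𝓘(ℝ, ℝ) ∞ g := by
  intro c
  obtain ⟨m, rfl⟩ := hs c
  obtain ⟨s, hs, -, hπs⟩ := exists_local_section hπ m
  refine ((hf _).comp _ hs).congr_of_eventuallyEq ?_
  filter_upwards [hπs] with c hc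
  simp only [Function.comp_apply]
  rw [← hg, hc]

/-- For a local section `s`, locally `η = s^*π^*η = s^*α`. -/
theorem DForm.smooth_of_pullback_isSubmersion [IsManifold 𝓘(ℝ, E) ∞ M] [IsManifold 𝓘(ℝ, F) ∞ C]
    (hπ : Manifold.IsSubmersion 𝓘(ℝ, E) 𝓘(ℝ, F) ∞ π) (hs : Function.Surjective π)
    {α : DForm E M 1} (hα : α.Smooth) {η : DForm F C 1} (hη : ∀ m, η.pullback E π m = α m) :
    η.Smooth := by
  refine DForm.smooth_of_eventuallyEq_pullback hα fun c => ?_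
  obtain ⟨m, rfl⟩ := hs c
  obtain ⟨s, hs, -, hπs⟩ := exists_local_section hπ m
  refine ⟨s, hs, ?_⟩
  filter_upwards [eventually_mdifferentiableAt hs, hπs.eventually_nhds] with c h1 h2
  have h3 : α.pullback F s c = (η.pullback E π).pullback F s c := by
    unfold DForm.pullback at hη ⊢
    rw [hη]
  rw [h3, DForm.pullback_pullback _ ((hπ.contMDiff _).mdifferentiableAt (by simp)) h1,
    DForm.pullback_congr (f := π ∘ s) (g := id) _ h2]
  unfold DForm.pullback
  rw [mfderiv_id]
  rfl

/-- A form killed, together with its exterior derivative, by the vertical vectors of a submersion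
is locally constant along the fibres. -/
theorem DForm.Smooth.eventually_eq_of_basic [IsManifold 𝓘(ℝ, E) ∞ M] [IsManifold 𝓘(ℝ, F) ∞ C]
    (hπ : Manifold.IsSubmersion 𝓘(ℝ, E) 𝓘(ℝ, F) ∞ π) {α : DForm E M 1} (hα : α.Smooth)
    (h0 : ∀ m u, tderiv E F π m u = 0 → α.toModel m ![u] = 0)
    (h1 : ∀ m u v, tderiv E F π m u = 0 → α.d.toModel m ![u, v] = 0) (m₀ : M) :
    ∀ᶠ m in 𝓝 m₀, π m = π m₀ → ∀ u v, tderiv E F π m u = tderiv E F π m₀ v →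
      α.toModel m ![u] = α.toModel m₀ ![v] := by
  obtain ⟨K, _, _, e, ψ, hm, he1, he2, hψ1, hψ2, h⟩ := exists_product_chart hπ m₀
  obtain ⟨r, hr, hball⟩ := Metric.isOpen_iff.1 e.open_target _ (e.map_source hm)
  have hs : ∀ p ∈ e.target, ContMDiffAt 𝓘(ℝ, F × K) 𝓘(ℝ, E) ∞ e.symm p := fun p hp =>
    he2.contMDiffAt (e.open_target.mem_nhds hp)
  have hsd : ∀ p ∈ e.target, MDifferentiableAt 𝓘(ℝ, F × K) 𝓘(ℝ, E) e.symm p := fun p hp =>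
    (hs p hp).mdifferentiableAt (by simp)
  have hed : ∀ m ∈ e.source, MDifferentiableAt 𝓘(ℝ, E) 𝓘(ℝ, F × K) e m := fun p hp =>
    (he1.contMDiffAt (e.open_source.mem_nhds hp)).mdifferentiableAt (by simp)
  have hπd : ∀ m, MDifferentiableAt 𝓘(ℝ, E) 𝓘(ℝ, F) π m := fun m =>
    (hπ.contMDiff m).mdifferentiableAt (by simp)
  have hfst : ∀ p, MDifferentiableAt 𝓘(ℝ, F × K) 𝓘(ℝ, F) (Prod.fst : F × K → F) p := fun p =>
    differentiableAt_fst.mdifferentiableAt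
  have hdfst : ∀ p, tderiv (F × K) F (Prod.fst : F × K → F) p =
      ContinuousLinearMap.fst ℝ F K := fun p => by
    rw [tderiv_eq_fderiv, fderiv_fst]
  -- In product coordinates `π` depends on the `F`-component only, so the vectors `(0, k)` are
  -- vertical.
  have hvert : ∀ p ∈ e.target, ∀ k : K,
      tderiv E F π (e.symm p) (tderiv (F × K) E e.symm p (0, k)) = 0 := by
    intro p hp k
    have h2 : π ∘ e.symm =ᶠ[𝓝 p] ψ.symm ∘ Prod.fst := by
      filter_upwards [e.open_target.mem_nhds hp] with q hq
      obtain ⟨h3, h4⟩ := h _ (e.map_target hq)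
      rw [e.right_inv hq] at h4
      simp only [Function.comp_apply]
      rw [← h4, ψ.left_inv h3]
    obtain ⟨h3, h4⟩ := h _ (e.map_target hp)
    rw [e.right_inv hp] at h4
    have h5 : MDifferentiableAt 𝓘(ℝ, F) 𝓘(ℝ, F) ψ.symm p.1 := by
      refine (hψ2.contMDiffAt (ψ.open_target.mem_nhds ?_)).mdifferentiableAt (by simp)
      rw [← h4]
      exact ψ.map_source h3
    have h6 := tderiv_congr (E := F × K) (F := F) h2
    rw [tderiv_comp (hπd _) (hsd p hp), tderiv_comp h5 (hfst p), hdfst] at h6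
    have h7 := congrArg (fun L : F × K →L[ℝ] F => L (0, k)) h6
    simpa using h7
  have hhor : ∀ m ∈ e.source, ∀ u : E, (tderiv E (F × K) e m u).1 =
      tderiv F F ψ (π m) (tderiv E F π m u) := by
    intro m hm u
    have h2 : ψ ∘ π =ᶠ[𝓝 m] Prod.fst ∘ e := by
      filter_upwards [e.open_source.mem_nhds hm] with q hq using (h q hq).2
    have h5 : MDifferentiableAt 𝓘(ℝ, F) 𝓘(ℝ, F) ψ (π m) :=
      (hψ1.contMDiffAt (ψ.open_source.mem_nhds (h m hm).1)).mdifferentiableAt (by simp)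
    have h6 := tderiv_congr (E := E) (F := F) h2
    rw [tderiv_comp h5 (hπd m), tderiv_comp (hfst _) (hed m hm), hdfst] at h6
    exact (congrArg (fun L : E →L[ℝ] F => L u) h6).symm
  have hinv : ∀ m ∈ e.source, ∀ u : E, tderiv (F × K) E e.symm (e m)
      (tderiv E (F × K) e m u) = u := by
    intro m hm u
    have h2 : e.symm ∘ e =ᶠ[𝓝 m] id := by
      filter_upwards [e.open_source.mem_nhds hm] with q hq using e.left_inv hq
    have h6 := tderiv_congr (E := E) (F := E) h2
    rw [tderiv_comp (hsd _ (e.map_source hm)) (hed m hm), tderiv_id] at h6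
    exact congrArg (fun L : E →L[ℝ] E => L u) h6
  -- `β` is the form in product coordinates. The hypotheses say that `β` and `dβ` both vanish on
  -- vectors `(0, k)`.
  obtain ⟨β, hβ⟩ : ∃ β : F × K → (F × K) [⋀^Fin 1]→L[ℝ] ℝ, β = α.pullback (F × K) e.symm :=
    ⟨_, rfl⟩
  have hβe : ∀ p w, β p ![w] = α.toModel (e.symm p) ![tderiv (F × K) E e.symm p w] := by
    intro p w
    rw [hβ]
    refine congrArg (α.toModel (e.symm p)) ?_
    ext i
    fin_cases i
    rfl
  have hβs : ∀ p ∈ e.target, ContDiffAt ℝ ∞ β p := by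
    rw [hβ]
    exact fun p hp => hα.contDiffAt_pullback (hs p hp)
  have hβ0 : ∀ p ∈ e.target, ∀ k : K, β p ![((0, k) : F × K)] = 0 := by
    intro p hp k
    rw [hβe]
    exact h0 _ _ (hvert p hp k)
  have hβ1 : ∀ p ∈ e.target, ∀ (k : K) (w : F × K), extDeriv β p ![((0, k) : F × K), w] = 0 := by
    intro p hp k w
    have h2 := hα.extDeriv_pullback (hs p hp)
    rw [hβ, h2]
    refine Eq.trans (congrArg (α.d.toModel (e.symm p)) ?_)
      (h1 _ _ (tderiv (F × K) E e.symm p w) (hvert p hp k))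
    ext i
    fin_cases i <;> rfl
  have hβα : ∀ m ∈ e.source, ∀ u : E, α.toModel m ![u] =
      β (e m) ![(tderiv F F ψ (π m) (tderiv E F π m u), (0 : K))] := by
    intro m hm u
    have h2 : tderiv E (F × K) e m u = (tderiv F F ψ (π m) (tderiv E F π m u), (0 : K)) +
        ((0 : F), (tderiv E (F × K) e m u).2) := by
      ext
      · simp [hhor m hm u]
      · simp
    have h3 : α.toModel m ![u] = β (e m) ![tderiv E (F × K) e m u] := by
      rw [hβe, hinv m hm, e.left_inv hm]
    have h4 : ∀ a b : F × K, β (e m) ![a + b] = β (e m) ![a] + β (e m) ![b] := fun a b => by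
      have h5 : ∀ x : F × K, Function.update ![a] 0 x = ![x] := fun x => by
        ext i <;> fin_cases i <;> rfl
      simpa only [h5] using (β (e m)).map_update_add ![a] 0 a b
    rw [h3, h2, h4, hβ0 _ (e.map_source hm), add_zero]
  -- The derivative of `β(w, 0)` in direction `(0, k)` is `dβ((0, k), (w, 0))` plus the derivative
  -- of `β(0, k)` in direction `(w, 0)`. Both vanish, so `β(w, 0)` is constant on the ball in `K`.
  have hconst : ∀ (t : K) (w : F), t ∈ Metric.ball (e m₀).2 r →
      β ((e m₀).1, t) ![(w, 0)] = β (e m₀) ![(w, 0)] := by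
    intro t w ht
    have hmem : ∀ t ∈ Metric.ball (e m₀).2 r, ((e m₀).1, t) ∈ e.target := fun t ht =>
      hball (by simpa [Prod.dist_eq, hr] using ht)
    have hd : ∀ t ∈ Metric.ball (e m₀).2 r, HasFDerivAt (fun t : K => β ((e m₀).1, t) ![(w, 0)])
        (0 : K →L[ℝ] ℝ) t := by
      intro t ht
      have hp := hmem t ht
      have hβd := (hβs _ hp).differentiableAt (by simp)
      have h2 : HasFDerivAt (fun p : F × K => β p ![(w, 0)])
          ((ContinuousAlternatingMap.apply ℝ (F × K) ℝ ![((w, 0) : F × K)]).comp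
            (fderiv ℝ β ((e m₀).1, t))) ((e m₀).1, t) :=
        (ContinuousAlternatingMap.apply ℝ (F × K) ℝ ![((w, 0) : F × K)]).hasFDerivAt.comp _
          hβd.hasFDerivAt
      have h3 : HasFDerivAt (fun t : K => ((e m₀).1, t)) (ContinuousLinearMap.inr ℝ F K) t :=
        hasFDerivAt_prodMk_right _ _
      refine (h2.comp t h3).congr_fderiv ?_
      ext k
      have h4 := hβ1 _ hp k (w, 0)
      rw [extDeriv_one_apply] at h4
      have h5 : HasFDerivAt (fun p : F × K => β p ![((0, k) : F × K)])
          ((ContinuousAlternatingMap.apply ℝ (F × K) ℝ ![((0, k) : F × K)]).comp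
            (fderiv ℝ β ((e m₀).1, t))) ((e m₀).1, t) :=
        (ContinuousAlternatingMap.apply ℝ (F × K) ℝ ![((0, k) : F × K)]).hasFDerivAt.comp _
          hβd.hasFDerivAt
      have h6 : HasFDerivAt (fun p : F × K => β p ![((0, k) : F × K)])
          (0 : F × K →L[ℝ] ℝ) ((e m₀).1, t) := by
        refine (hasFDerivAt_const (0 : ℝ) _).congr_of_eventuallyEq ?_
        filter_upwards [e.open_target.mem_nhds hp] with q hq using hβ0 q hq k
      have h7 := congrArg (fun L : F × K →L[ℝ] ℝ => L (w, 0)) (h5.unique h6)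
      have h8 : fderiv ℝ β ((e m₀).1, t) (w, 0) ![((0, k) : F × K)] = 0 := h7
      rw [h8, sub_zero] at h4
      exact h4
    exact Metric.isOpen_ball.is_const_of_fderiv_eq_zero (convex_ball _ _).isPreconnected
      (fun t ht => (hd t ht).differentiableAt.differentiableWithinAt)
      (fun t ht => (hd t ht).fderiv) ht (Metric.mem_ball_self hr)
  filter_upwards [e.open_source.mem_nhds hm,
    (e.continuousAt hm).eventually_mem (Metric.ball_mem_nhds _ hr)] with m hm1 hm2 hmm u v huv
  -- Points of one fibre share the `F`-coordinate, since it equals `ψ ∘ π`.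
  have hem : e m = ((e m₀).1, (e m).2) := by
    ext
    · simp only
      rw [← (h m hm1).2, hmm, (h m₀ hm).2]
    · rfl
  rw [hβα m hm1, hβα m₀ hm, huv, hem, hconst, hmm]
  rw [Metric.mem_ball, Prod.dist_eq] at hm2
  exact lt_of_le_of_lt (le_max_right _ _) hm2

end Submersions

/-! ### Descent of functions and forms to the orbit space -/

section Orbits

universe u
variable {E : Type u} [NormedAddCommGroup E] [NormedSpace ℝ E]
  {M : Type*} [TopologicalSpace M] [ChartedSpace E M] [IsManifold 𝓘(ℝ, E) ∞ M]
  {F : Type*} [NormedAddCommGroup F] [NormedSpace ℝ F]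
  {C : Type*} [TopologicalSpace C] [ChartedSpace F C] [IsManifold 𝓘(ℝ, F) ∞ C]
  {D : VField E M} {π : M → C}

omit [IsManifold 𝓘(ℝ, E) ∞ M] in
theorem isMIntegralCurveOn_Ioo_hasMFDerivAt {γ : ℝ → M} {a b : ℝ}
    (hγ : IsMIntegralCurveOn γ D (Ioo a b)) {t : ℝ} (ht : t ∈ Ioo a b) :
    HasMFDerivAt 𝓘(ℝ, ℝ) 𝓘(ℝ, E) γ t ((1 : ℝ →L[ℝ] ℝ).smulRight (D (γ t))) :=
  (hγ t ht).hasMFDerivAt (isOpen_Ioo.mem_nhds ht)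

omit [IsManifold 𝓘(ℝ, E) ∞ M] in
theorem SameOrbit.eq_of_deriv_eq_zero {f : M → ℝ}
    (hf : MDifferentiable 𝓘(ℝ, E) 𝓘(ℝ, ℝ) f) (hDf : ∀ m, D.deriv f m = 0) {x y : M}
    (h : SameOrbit D x y) : f x = f y := by
  obtain ⟨γ, a, b, hγ, ⟨s, hs, rfl⟩, ⟨t, ht, rfl⟩⟩ := h
  have hd : ∀ t ∈ Ioo a b, HasDerivAt (f ∘ γ) 0 t := by
    intro t ht
    have h1 := ((hf (γ t)).hasMFDerivAt.comp t (isMIntegralCurveOn_Ioo_hasMFDerivAt hγ ht))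
    have h2 : HasFDerivAt (f ∘ γ) ((tderiv E ℝ f (γ t)).comp
        ((1 : ℝ →L[ℝ] ℝ).smulRight (D (γ t) : E))) t := hasMFDerivAt_iff_hasFDerivAt.1 h1
    have h4 : tderiv E ℝ f (γ t) (D (γ t)) = 0 := hDf (γ t)
    have h5 : ((tderiv E ℝ f (γ t)).comp ((1 : ℝ →L[ℝ] ℝ).smulRight (D (γ t) : E))) 1 = 0 := by
      exact (congrArg (tderiv E ℝ f (γ t)) (one_smul ℝ (D (γ t) : E))).trans h4
    have h6 := h2.hasDerivAt
    rwa [h5] at h6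
  exact isOpen_Ioo.is_const_of_deriv_eq_zero isPreconnected_Ioo
    (fun t ht => (hd t ht).differentiableAt.differentiableWithinAt) (fun t ht => (hd t ht).deriv)
    hs ht

-- The interval carrying the integral curve is connected, so a local relation propagates along it.
-- The local hypothesis concerns only points of one orbit, which is what basic forms provide.
omit [IsManifold 𝓘(ℝ, E) ∞ M] in
theorem SameOrbit.rel_of_eventually {P : M → M → Prop} (hsymm : ∀ x y, P x y → P y x)
    (htrans : ∀ x y z, P x y → P y z → P x z)
    (hP : ∀ x, ∀ᶠ y in 𝓝 x, SameOrbit D x y → P x y) {x y : M} (h : SameOrbit D x y) : P x y := by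
  obtain ⟨γ, a, b, hγ, ⟨s, hs, rfl⟩, ⟨t, ht, rfl⟩⟩ := h
  refine isPreconnected_Ioo.induction₂ (fun s t => P (γ s) (γ t)) (fun s hs => ?_)
    (fun x y z _ _ _ => htrans _ _ _) (fun x y _ _ => hsymm _ _) hs ht
  have hc : ContinuousWithinAt γ (Ioo a b) s := (hγ s hs).continuousWithinAt
  filter_upwards [hc.eventually (hP (γ s)), self_mem_nhdsWithin] with t h1 h2
  exact h1 ⟨γ, a, b, hγ, ⟨s, hs, rfl⟩, ⟨t, h2, rfl⟩⟩

-- An integral curve of `D` through `m` stays in one fibre, so `π` is constant along it;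
-- differentiate at time zero. Completeness of `E` is used for the existence of the curve.
omit [IsManifold 𝓘(ℝ, F) ∞ C] in
theorem IsOrbitSpace.tderiv_field [CompleteSpace E] (hπ : IsOrbitSpace (F := F) D π)
    (hD : D.Smooth) (m : M) : tderiv E F π m (D.toModel m) = 0 := by
  have hD1 : ContMDiffAt 𝓘(ℝ, E) 𝓘(ℝ, E).tangent 1
    (fun x => (⟨x, D x⟩ : TangentBundle 𝓘(ℝ, E) M)) m := (hD m).of_le (by simp)
  obtain ⟨γ, hγ0, hγ⟩ := exists_isMIntegralCurveAt_of_contMDiffAt_boundaryless (t₀ := 0) hD1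
  obtain ⟨r, hr, hγr⟩ := isMIntegralCurveAt_iff'.1 hγ
  rw [Real.ball_eq_Ioo] at hγr
  have h0 : (0 : ℝ) ∈ Ioo (0 - r) (0 + r) := by constructor <;> linarith
  have h1 : π ∘ γ =ᶠ[𝓝 0] fun _ => π m := by
    filter_upwards [isOpen_Ioo.mem_nhds h0] with t ht
    rw [← hγ0]
    exact (hπ.eq_iff _ _).2 ⟨γ, _, _, hγr, ⟨t, ht, rfl⟩, ⟨0, h0, rfl⟩⟩
  have h2 := isMIntegralCurveOn_Ioo_hasMFDerivAt hγr h0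
  have h3 := (((hπ.submersion.contMDiff (γ 0)).mdifferentiableAt (by simp)).hasMFDerivAt.comp
    (0 : ℝ) h2).mfderiv
  have h4 := tderiv_congr (E := ℝ) (F := F) h1
  have h5 : tderiv ℝ F (fun _ : ℝ => π m) 0 = 0 := mfderiv_const
  have h6 := congrArg (fun L : ℝ →L[ℝ] F => L 1) ((h4.symm.trans h3).symm.trans h5)
  have h7 : tderiv E F π (γ 0) ((1 : ℝ) • (D (γ 0))) = 0 := h6
  rw [one_smul, hγ0] at h7
  exact h7

theorem IsOrbitSpace.exists_descended_function (hπ : IsOrbitSpace (F := F) D π) {f : M → ℝ}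
    (hf : ContMDiff 𝓘(ℝ, E) 𝓘(ℝ, ℝ) ∞ f) (hDf : ∀ m, D.deriv f m = 0) :
    ∃ g : C → ℝ, ContMDiff 𝓘(ℝ, F) 𝓘(ℝ, ℝ) ∞ g ∧ ∀ m, g (π m) = f m := by
  have h : ∀ m, f (Function.surjInv hπ.surjective (π m)) = f m := fun m =>
    ((hπ.eq_iff _ _).1 (Function.surjInv_eq hπ.surjective (π m))).eq_of_deriv_eq_zero
      (hf.mdifferentiable (by simp)) hDf
  exact ⟨fun c => f (Function.surjInv hπ.surjective c),
    contMDiff_of_comp_isSubmersion hπ.submersion hπ.surjective hf h, h⟩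

/-- The relation `P x y` says that `α` at `x` and at `y` induce the same form on the tangent space
of `C`. It holds locally in a fibre, hence along orbits. -/
theorem IsOrbitSpace.exists_descended_form (hπ : IsOrbitSpace (F := F) D π) {α : DForm E M 1}
    (hα : α.Smooth)
    (h0 : ∀ m u, tderiv E F π m u = 0 → α.toModel m ![u] = 0)
    (h1 : ∀ m u v, tderiv E F π m u = 0 → α.d.toModel m ![u, v] = 0) :
    ∃ η : DForm F C 1, η.Smooth ∧ ∀ m, η.pullback E π m = α m := by
  let P : M → M → Prop := fun x y => ∀ u v, tderiv E F π x u = tderiv E F π y v →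
    α.toModel x ![u] = α.toModel y ![v]
  choose L hL using exists_rightInverse_tderiv hπ.submersion
  have hP : ∀ x y, SameOrbit D x y → P x y := by
    intro x y
    refine SameOrbit.rel_of_eventually (fun x y h u v huv => (h v u huv.symm).symm)
      (fun x y z h h' u v huv => ?_) fun x => ?_
    -- Transitivity needs a vector at the middle point with the same projection; surjectivity of
    -- `dπ` supplies it.
    · exact (h u (L y (tderiv E F π x u)) (hL _ _).symm).trans (h' _ v ((hL _ _).trans huv))
    · filter_upwards [hα.eventually_eq_of_basic hπ.submersion h0 h1 x] with y hy hxy u v huv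
      exact (hy ((hπ.eq_iff _ _).2 hxy).symm v u huv.symm).symm
  let s := Function.surjInv hπ.surjective
  have hs : ∀ c, π (s c) = c := Function.surjInv_eq hπ.surjective
  -- Both `s` and `L` are chosen pointwise with no regularity. Smoothness of `η` is recovered
  -- afterwards from that of its pullback.
  let η : DForm F C 1 := fun c => (α.toModel (s c)).compContinuousLinearMap (L (s c))
  have hη : ∀ m, η.pullback E π m = α m := by
    intro m
    ext u
    change α.toModel (s (π m)) (fun i => L (s (π m)) (tderiv E F π m (u i))) = α.toModel m u
    have e1 : (fun i => L (s (π m)) (tderiv E F π m (u i))) =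
        ![L (s (π m)) (tderiv E F π m (u 0))] := by
      ext i
      fin_cases i
      rfl
    have e2 : u = ![u 0] := by
      ext i
      fin_cases i
      rfl
    rw [e1, e2]
    exact hP _ _ ((hπ.eq_iff _ _).1 (hs _)) _ _ (hL _ _)
  exact ⟨η, DForm.smooth_of_pullback_isSubmersion hπ.submersion hπ.surjective hα hη, hη⟩

end Orbits

/-! ### Linear algebra: one-dimensional kernels and nondegenerate forms -/

section LinearAlgebra

variable {E F : Type*} [AddCommGroup E] [Module ℝ E] [FiniteDimensional ℝ E]
  [AddCommGroup F] [Module ℝ F]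

theorem exists_smul_eq_of_map_eq_zero (L : E →ₗ[ℝ] F) (hL : Function.Surjective L)
    (hd : Module.finrank ℝ E = Module.finrank ℝ F + 1) {d u : E} (hd0 : d ≠ 0) (hLd : L d = 0)
    (hLu : L u = 0) : ∃ c : ℝ, u = c • d := by
  have h1 := L.finrank_range_add_finrank_ker
  rw [LinearMap.range_eq_top.2 hL, finrank_top] at h1
  have h2 : Module.finrank ℝ L.ker = 1 := by omega
  obtain ⟨c, hc⟩ := (finrank_eq_one_iff_of_nonzero' (⟨d, hLd⟩ : L.ker)
    (by simpa [Subtype.ext_iff] using hd0)).1 h2 ⟨u, hLu⟩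
  exact ⟨c, (congrArg Subtype.val hc).symm⟩

theorem exists_eq_of_nondegenerate (B : E →ₗ[ℝ] E →ₗ[ℝ] ℝ)
    (hB : ∀ u, (∀ v, B u v = 0) → u = 0) (θ : E →ₗ[ℝ] ℝ) : ∃ u, ∀ v, B u v = θ v := by
  have hinj : Function.Injective B :=
    (injective_iff_map_eq_zero B).2 fun u hu => hB u fun v => by rw [hu]; rfl
  have hs := (LinearMap.injective_iff_surjective_of_finrank_eq_finrank
    (Subspace.dual_finrank_eq (K := ℝ) (V := E)).symm (f := B)).1 hinj
  obtain ⟨u, hu⟩ := hs θ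
  exact ⟨u, fun v => by rw [hu]⟩

end LinearAlgebra

/-! ### Real powers with a chosen sign -/

section SignedPow

theorem signedPow_ne_zero (ε : ℤˣ) (a : ℝ) {x : ℝ} (hx : x ≠ 0) : signedPow ε a x ≠ 0 := by
  unfold signedPow
  split_ifs with h
  · exact (Real.rpow_pos_of_pos h a).ne'
  · exact mul_ne_zero (by exact_mod_cast ε.ne_zero)
      (Real.rpow_pos_of_pos (abs_pos.2 hx) a).ne'

theorem units_int_mul_self_cast (ε : ℤˣ) : ((ε : ℤ) : ℝ) * ((ε : ℤ) : ℝ) = 1 := by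
  rcases Int.units_eq_one_or ε with rfl | rfl <;> norm_num

theorem signedPow_mul_signedPow_neg (ε : ℤˣ) (a : ℝ) {x : ℝ} (hx : x ≠ 0) :
    signedPow ε a x * signedPow ε (-a) x = 1 := by
  unfold signedPow
  split_ifs with h
  · rw [← Real.rpow_add h, add_neg_cancel, Real.rpow_zero]
  · rw [mul_mul_mul_comm, units_int_mul_self_cast, ← Real.rpow_add (abs_pos.2 hx),
      add_neg_cancel, Real.rpow_zero, one_mul]

/-- For `x < 0` one has `x / (ε|x|^a) = -ε|x|^(1-a)`, because `ε⁻¹ = ε`. The sign attached to the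
exponent `1 - a` is therefore `-ε`. -/
theorem signedPow_neg_one_sub (ε : ℤˣ) (a : ℝ) {x : ℝ} (hx : x ≠ 0) :
    signedPow (-ε) (1 - a) x = x / signedPow ε a x := by
  have h := signedPow_mul_signedPow_neg ε a hx
  rw [eq_div_iff (signedPow_ne_zero ε a hx)]
  unfold signedPow at *
  split_ifs at * with h0
  · rw [← Real.rpow_add h0, sub_add_cancel, Real.rpow_one]
  · rw [mul_mul_mul_comm, ← Real.rpow_add (abs_pos.2 hx), sub_add_cancel, Real.rpow_one,
      abs_of_neg (lt_of_le_of_ne (not_lt.1 h0) hx)]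
    push_cast
    linear_combination x * units_int_mul_self_cast ε

/-- The power is a homomorphism on nonzero reals: `|x|^a` times a character of the sign of `x`. The
cases differ only in how `ε` cancels. -/
theorem signedPow_div (ε : ℤˣ) (a : ℝ) {x y : ℝ} (hx : x ≠ 0) (hy : y ≠ 0) :
    signedPow ε a (y / x) = signedPow ε a y / signedPow ε a x := by
  rw [eq_div_iff (signedPow_ne_zero ε a hx)]
  have h1 := units_int_mul_self_cast ε
  rcases lt_or_gt_of_ne hx with h | h <;> rcases lt_or_gt_of_ne hy with h' | h'
  · have h2 : |y / x| ^ a * |x| ^ a = |y| ^ a := by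
      rw [← Real.mul_rpow (abs_nonneg _) (abs_nonneg _), ← abs_mul, div_mul_cancel₀ _ hx]
    have h3 := div_pos_of_neg_of_neg h' h
    rw [abs_of_pos h3] at h2
    simp only [signedPow, h3, if_true, not_lt.2 h.le, not_lt.2 h'.le, if_false]
    linear_combination ((ε : ℤ) : ℝ) * h2
  · have h2 : |y / x| ^ a * |x| ^ a = |y| ^ a := by
      rw [← Real.mul_rpow (abs_nonneg _) (abs_nonneg _), ← abs_mul, div_mul_cancel₀ _ hx]
    have h3 := div_neg_of_pos_of_neg h' h
    rw [abs_of_pos h'] at h2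
    simp only [signedPow, not_lt.2 h3.le, not_lt.2 h.le, h', if_true, if_false]
    linear_combination h2 + |y / x| ^ a * |x| ^ a * h1
  · have h2 : |y / x| ^ a * |x| ^ a = |y| ^ a := by
      rw [← Real.mul_rpow (abs_nonneg _) (abs_nonneg _), ← abs_mul, div_mul_cancel₀ _ hx]
    have h3 := div_neg_of_neg_of_pos h' h
    rw [abs_of_pos h] at h2
    simp only [signedPow, not_lt.2 h3.le, h, not_lt.2 h'.le, if_true, if_false]
    linear_combination ((ε : ℤ) : ℝ) * h2
  · have h2 : |y / x| ^ a * |x| ^ a = |y| ^ a := by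
      rw [← Real.mul_rpow (abs_nonneg _) (abs_nonneg _), ← abs_mul, div_mul_cancel₀ _ hx]
    have h3 := div_pos h' h
    rw [abs_of_pos h3, abs_of_pos h, abs_of_pos h'] at h2
    simp only [signedPow, h3, h, h', if_true]
    exact h2

theorem signedPow_eventuallyEq_of_neg (ε : ℤˣ) (a : ℝ) {x : ℝ} (hx : x < 0) :
    signedPow ε a =ᶠ[𝓝 x] fun y => ((ε : ℤ) : ℝ) * (-y) ^ a := by
  filter_upwards [eventually_lt_nhds hx] with y hy
  simp [signedPow, not_lt.2 hy.le, abs_of_neg hy]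

theorem signedPow_eventuallyEq_of_pos (ε : ℤˣ) (a : ℝ) {x : ℝ} (hx : 0 < x) :
    signedPow ε a =ᶠ[𝓝 x] fun y => y ^ a := by
  filter_upwards [eventually_gt_nhds hx] with y hy
  exact signedPow_of_pos ε a hy

theorem contDiffAt_signedPow (ε : ℤˣ) (a : ℝ) {x : ℝ} (hx : x ≠ 0) :
    ContDiffAt ℝ ∞ (signedPow ε a) x := by
  rcases lt_or_gt_of_ne hx with h | h
  · refine ContDiffAt.congr_of_eventuallyEq ?_ (signedPow_eventuallyEq_of_neg ε a h)
    exact contDiffAt_const.mul (contDiffAt_id.neg.rpow_const_of_ne (by simpa using hx))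
  · refine ContDiffAt.congr_of_eventuallyEq ?_ (signedPow_eventuallyEq_of_pos ε a h)
    exact contDiffAt_id.rpow_const_of_ne hx

theorem hasDerivAt_signedPow (ε : ℤˣ) (a : ℝ) {x : ℝ} (hx : x ≠ 0) :
    HasDerivAt (signedPow ε a) (a * signedPow ε a x / x) x := by
  rcases lt_or_gt_of_ne hx with h | h
  · have h1 := signedPow_eventuallyEq_of_neg ε a h
    refine HasDerivAt.congr_of_eventuallyEq ?_ h1
    rw [h1.eq_of_nhds]
    have h2 := ((hasDerivAt_neg x).rpow_const (p := a) (Or.inl (neg_ne_zero.2 hx))).const_mul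
      (((ε : ℤ) : ℝ))
    refine h2.congr_deriv ?_
    rw [Real.rpow_sub_one (neg_ne_zero.2 hx)]
    field_simp
  · have h1 := signedPow_eventuallyEq_of_pos ε a h
    refine HasDerivAt.congr_of_eventuallyEq ?_ h1
    rw [h1.eq_of_nhds]
    refine (Real.hasDerivAt_rpow_const (p := a) (Or.inl hx)).congr_deriv ?_
    rw [Real.rpow_sub_one hx]
    field_simp

end SignedPow

/-! ### Forms of degree one and two as linear and bilinear maps -/

section Evaluation

variable {E : Type*} [NormedAddCommGroup E] [NormedSpace ℝ E]
  {M : Type*} [TopologicalSpace M] [ChartedSpace E M]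
  {F : Type*} [NormedAddCommGroup F] [NormedSpace ℝ F]
  {C : Type*} [TopologicalSpace C] [ChartedSpace F C]

variable (E) in
/-- Alternating forms of degree one as linear forms. -/
def uncurryOne : (E [⋀^Fin 1]→L[ℝ] ℝ) →L[ℝ] E →L[ℝ] ℝ :=
  (ContinuousAlternatingMap.ofSubsingletonLIE (𝕜 := ℝ) (E := E) (F := ℝ)
    (0 : Fin 1)).symm.toContinuousLinearEquiv

theorem uncurryOne_apply (θ : E [⋀^Fin 1]→L[ℝ] ℝ) (u : E) : uncurryOne E θ u = θ ![u] := by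
  change θ (fun _ => u) = _
  congr 1
  ext i
  fin_cases i
  rfl

/-- Alternating forms of degree two as bilinear forms. -/
def uncurryTwo (θ : E [⋀^Fin 2]→L[ℝ] ℝ) : E →L[ℝ] E →L[ℝ] ℝ :=
  (uncurryOne E).comp (ContinuousAlternatingMap.curryLeft θ)

theorem uncurryTwo_apply (θ : E [⋀^Fin 2]→L[ℝ] ℝ) (u v : E) : uncurryTwo θ u v = θ ![u, v] :=
  uncurryOne_apply _ _

theorem contDiff_uncurryTwo :
    ContDiff ℝ ∞ (uncurryTwo : (E [⋀^Fin 2]→L[ℝ] ℝ) → E →L[ℝ] E →L[ℝ] ℝ) :=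
  contDiff_const.clm_comp contDiff_curryLeft

theorem contDiff_alternatizeUncurryFin {k : ℕ} : ContDiff ℝ ∞
    (fun θ : E →L[ℝ] E [⋀^Fin k]→L[ℝ] ℝ => ContinuousAlternatingMap.alternatizeUncurryFin θ) := by
  apply IsBoundedLinearMap.contDiff
  exact IsLinearMap.with_bound ⟨ContinuousAlternatingMap.alternatizeUncurryFin_add,
    fun c θ => ContinuousAlternatingMap.alternatizeUncurryFin_smul c θ⟩ (k + 1)
    ContinuousAlternatingMap.norm_alternatizeUncurryFin_le

/-- The linear form given by a 1-form at a point. -/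
def DForm.ev₁ (α : DForm E M 1) (x : M) : E →L[ℝ] ℝ := uncurryOne E (α.toModel x)

/-- The bilinear form given by a 2-form at a point. -/
def DForm.ev₂ (α : DForm E M 2) (x : M) : E →L[ℝ] E →L[ℝ] ℝ := uncurryTwo (α.toModel x)

theorem DForm.ev₁_apply (α : DForm E M 1) (x : M) (u : TangentSpace 𝓘(ℝ, E) x) :
    α.ev₁ x u = α x ![u] := uncurryOne_apply _ _

theorem DForm.ev₂_apply (α : DForm E M 2) (x : M) (u v : TangentSpace 𝓘(ℝ, E) x) :
    α.ev₂ x u v = α x ![u, v] := uncurryTwo_apply _ _ _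

theorem DForm.ev₂_self (α : DForm E M 2) (x : M) (u : E) : α.ev₂ x u u = 0 :=
  (uncurryTwo_apply _ _ _).trans
    ((α.toModel x).map_eq_zero_of_eq ![u, u] (i := 0) (j := 1) rfl (by simp))

theorem DForm.ev₂_swap (α : DForm E M 2) (x : M) (u v : E) : α.ev₂ x u v = -α.ev₂ x v u := by
  have h := α.ev₂_self x (u + v)
  simp only [map_add, add_apply, α.ev₂_self] at h
  linarith

theorem DForm.ev₁_pullback (α : DForm F C 1) (f : M → C) (x : M) (u : E) :
    (α.pullback E f).ev₁ x u = α.ev₁ (f x) (tderiv E F f x u) := by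
  refine (uncurryOne_apply _ _).trans ((uncurryOne_apply (α.toModel (f x)) _).trans ?_).symm
  change _ = α.toModel (f x) (fun i => tderiv E F f x ((![u] : Fin 1 → E) i))
  congr 1
  ext i
  fin_cases i
  rfl

theorem DForm.ev₂_pullback (α : DForm F C 2) (f : M → C) (x : M) (u v : E) :
    (α.pullback E f).ev₂ x u v = α.ev₂ (f x) (tderiv E F f x u) (tderiv E F f x v) := by
  refine (uncurryTwo_apply _ _ _).trans ((uncurryTwo_apply (α.toModel (f x)) _ _).trans ?_).symm
  change _ = α.toModel (f x) (fun i => tderiv E F f x ((![u, v] : Fin 2 → E) i))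
  congr 1
  ext i
  fin_cases i <;> rfl

theorem DForm.ext₁ {α β : DForm E M 1} {x : M} (h : ∀ u, α.ev₁ x u = β.ev₁ x u) : α x = β x := by
  ext v
  have e : v = ![v 0] := by
    ext i
    fin_cases i
    rfl
  have h1 := h (v 0)
  have h2 := α.ev₁_apply x (v 0)
  have h3 := β.ev₁_apply x (v 0)
  rw [e]
  exact h2.symm.trans (h1.trans h3)

theorem DForm.ev₂_d_smul [IsManifold 𝓘(ℝ, E) ∞ M] {α : DForm E M 1} (hα : α.Smooth)
    {f : M → ℝ} (hf : ContMDiff 𝓘(ℝ, E) 𝓘(ℝ, ℝ) ∞ f) (x : M) (u v : E) :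
    (DForm.d (fun x => f x • α x)).ev₂ x u v =
      tderiv E ℝ f x u * α.ev₁ x v - tderiv E ℝ f x v * α.ev₁ x u + f x * α.d.ev₂ x u v := by
  have h1 := DForm.ev₂_apply (DForm.d (fun x => f x • α x)) x u v
  have h2 := DForm.ev₂_apply α.d x u v
  have h3 := DForm.ev₁_apply α x u
  have h4 := DForm.ev₁_apply α x v
  rw [h2, h3, h4]
  exact h1.trans (DForm.d_smul_apply hα hf x u v)

end Evaluation

/-! ### Contact forms: separation of vectors and smoothness of solutions -/

section Contact

variable {F : Type*} [NormedAddCommGroup F] [NormedSpace ℝ F]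
  {C : Type*} [TopologicalSpace C] [ChartedSpace F C] {η : DForm F C 1}

theorem IsContactForm.eq_zero (hη : IsContactForm η) {x : C} {u : F} (h1 : η.ev₁ x u = 0)
    (h2 : ∀ v, η.ev₁ x v = 0 → η.d.ev₂ x u v = 0) : u = 0 :=
  hη.nondegenerate x u ((η.ev₁_apply x u).symm.trans h1) fun v hv =>
    (η.d.ev₂_apply x u v).symm.trans (h2 v ((η.ev₁_apply x v).trans hv))

/-- The source of every uniqueness statement about vectors on `C`: Reeb field, contact Hamiltonian
field, and the comparison with the push-forward. -/
theorem IsContactForm.eq_of_forall (hη : IsContactForm η) {x : C} {u u' : F}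
    (h1 : η.ev₁ x u = η.ev₁ x u') (h2 : ∀ v, η.d.ev₂ x u v = η.d.ev₂ x u' v) : u = u' := by
  refine sub_eq_zero.1 (hη.eq_zero (x := x) ?_ fun v _ => ?_)
  · rw [map_sub, h1, sub_self]
  · rw [map_sub, sub_apply, h2, sub_self]

/-- A vector field given by the values of `i_X dη + η(X) η` is smooth. -/
theorem IsContactForm.smooth_of_forall [FiniteDimensional ℝ F] [IsManifold 𝓘(ℝ, F) ∞ C]
    (hη : IsContactForm η) {X : VField F C} {f g : C → ℝ}
    (hf : ContMDiff 𝓘(ℝ, F) 𝓘(ℝ, ℝ) ∞ f) (hg : ContMDiff 𝓘(ℝ, F) 𝓘(ℝ, ℝ) ∞ g)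
    (hX : ∀ x v, η.d.ev₂ x (X x) v + η.ev₁ x (X x) * η.ev₁ x v =
      tderiv F ℝ f x v + g x * η.ev₁ x v) : X.Smooth := by
  rw [VField.smooth_iff_inChart]
  intro x₀ y hy
  apply ContDiffAt.contDiffWithinAt
  let φ := extChartAt 𝓘(ℝ, F) x₀
  let a : F → F →L[ℝ] ℝ := fun y => uncurryOne F (η.inChart x₀ y)
  -- In the chart the equation reads `B X = t` with `B = dη + η ⊗ η`, so `X = B⁻¹ t`, and inversion
  -- of linear maps is smooth.
  let B : F → F →L[ℝ] F →L[ℝ] ℝ := fun y =>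
    uncurryTwo (extDeriv (η.inChart x₀) y) + (a y).smulRight (a y)
  let t : F → F →L[ℝ] ℝ := fun y =>
    fderiv ℝ (fun z => f (φ.symm z)) y + g (φ.symm y) • a y
  have ha : ContDiffAt ℝ ∞ a y :=
    (uncurryOne F).contDiff.contDiffAt.comp y (hη.smooth.contDiffAt hy)
  have hd : ContDiffAt ℝ ∞ (extDeriv (η.inChart x₀)) y :=
    contDiff_alternatizeUncurryFin.contDiffAt.comp y
      ((hη.smooth.contDiffAt hy).fderiv_right (m := ∞) (by simp))
  have hB : ContDiffAt ℝ ∞ B y :=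
    (contDiff_uncurryTwo.contDiffAt.comp y hd).add (ha.smulRight ha)
  have ht : ContDiffAt ℝ ∞ t y :=
    ((contDiffAt_comp_extChartAt_symm hf hy).fderiv_right (m := ∞) (by simp)).add
      ((contDiffAt_comp_extChartAt_symm hg hy).smul ha)
  have ha' : ∀ y u, a y u = η.ev₁ (φ.symm y) (tderiv F F φ.symm y u) := fun y u =>
    DForm.ev₁_pullback η φ.symm y u
  have hB' : ∀ y ∈ φ.target, ∀ u v, B y u v =
      η.d.ev₂ (φ.symm y) (tderiv F F φ.symm y u) (tderiv F F φ.symm y v) +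
      η.ev₁ (φ.symm y) (tderiv F F φ.symm y u) * η.ev₁ (φ.symm y) (tderiv F F φ.symm y v) := by
    intro y hy u v
    rw [← DForm.ev₂_pullback η.d φ.symm y u v, ← ha', ← ha']
    simp only [B, add_apply, ContinuousLinearMap.smulRight_apply, smul_apply, smul_eq_mul]
    rw [← hη.smooth.d_inChart hy]
    rfl
  have ht' : ∀ y ∈ φ.target, ∀ v, t y v = tderiv F ℝ f (φ.symm y) (tderiv F F φ.symm y v) +
      g (φ.symm y) * η.ev₁ (φ.symm y) (tderiv F F φ.symm y v) := by
    intro y hy v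
    rw [← ha']
    simp only [t, add_apply, smul_apply, smul_eq_mul]
    congr 1
    have h1 := tderiv_comp (G := F) (F := ℝ) (E := F) ((hf (φ.symm y)).mdifferentiableAt (by simp))
      ((contMDiffAt_extChartAt_symm_of_mem hy).mdifferentiableAt (by simp))
    rw [tderiv_eq_fderiv] at h1
    exact congrArg (fun L : F →L[ℝ] ℝ => L v) h1
  have hT : ∀ y ∈ φ.target, ∀ v : F, ∃ w : F, tderiv F F φ.symm y w = v := by
    intro y hy v
    have h1 := mfderiv_symm_mfderiv_extChartAt (φ.map_target hy) v
    rw [φ.right_inv hy] at h1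
    exact ⟨_, h1⟩
  have hT0 : ∀ y ∈ φ.target, ∀ v : F, tderiv F F φ.symm y v = 0 → v = 0 := by
    intro y hy v hv
    have h1 := mfderiv_extChartAt_mfderiv_symm hy v
    refine h1.symm.trans ?_
    refine (congrArg (tderiv F F φ (φ.symm y)) hv).trans (map_zero _)
  have hinj : ∀ y ∈ φ.target, Function.Injective (B y) := by
    intro y hy
    refine (injective_iff_map_eq_zero (B y)).2 fun u hu => hT0 y hy u ?_
    have h1 : ∀ v, η.d.ev₂ (φ.symm y) (tderiv F F φ.symm y u) v +
        η.ev₁ (φ.symm y) (tderiv F F φ.symm y u) * η.ev₁ (φ.symm y) v = 0 := by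
      intro v
      obtain ⟨w, rfl⟩ := hT y hy v
      rw [← hB' y hy, hu]
      rfl
    -- Pairing the vector with itself kills the `dη` term and leaves `η(u)² = 0`.
    have h2 : η.ev₁ (φ.symm y) (tderiv F F φ.symm y u) = 0 := by
      have h3 := h1 (tderiv F F φ.symm y u)
      rw [DForm.ev₂_self, zero_add] at h3
      exact mul_self_eq_zero.1 h3
    refine hη.eq_zero h2 fun v _ => ?_
    have h3 := h1 v
    rwa [h2, zero_mul, add_zero] at h3
  have hequiv : ∀ y ∈ φ.target, ∃ e : F ≃L[ℝ] (F →L[ℝ] ℝ), (e : F →L[ℝ] F →L[ℝ] ℝ) = B y := by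
    intro y hy
    have hfin : Module.finrank ℝ F = Module.finrank ℝ (F →L[ℝ] ℝ) := by
      rw [(LinearMap.toContinuousLinearMap (𝕜 := ℝ) (E := F) (F' := ℝ)).symm.finrank_eq]
      exact (Subspace.dual_finrank_eq (K := ℝ) (V := F)).symm
    refine ⟨(LinearEquiv.ofInjectiveOfFinrankEq (B y : F →ₗ[ℝ] F →L[ℝ] ℝ) (hinj y hy)
      hfin).toContinuousLinearEquiv, ?_⟩
    ext u
    rfl
  have hsol : ∀ y ∈ φ.target, X.inChart x₀ y = (B y).inverse (t y) := by
    intro y hy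
    obtain ⟨e, he⟩ := hequiv y hy
    have h1 : B y (X.inChart x₀ y) = t y := by
      ext v
      have h2 : tderiv F F φ.symm y (X.inChart x₀ y) = X (φ.symm y) := X.mfderiv_symm_inChart hy
      rw [hB' y hy, ht' y hy, h2]
      exact hX _ _
    rw [← h1, ← he, ContinuousLinearMap.inverse_equiv]
    exact (e.symm_apply_apply _).symm
  obtain ⟨e, he⟩ := hequiv y hy
  have hinv : ContDiffAt ℝ ∞ (fun z => (B z).inverse) y := by
    have h1 : ContDiffAt ℝ ∞ (ContinuousLinearMap.inverse : (F →L[ℝ] F →L[ℝ] ℝ) → _) (B y) := by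
      rw [← he]
      exact contDiffAt_map_inverse e
    exact h1.comp y hB
  refine (hinv.clm_apply ht).congr_of_eventuallyEq ?_
  filter_upwards [(isOpen_extChartAt_target x₀).mem_nhds hy] with z hz using hsol z hz

end Contact

/-! ### The form `λ/ρ`, its descent, and the contact condition -/

section ReductionProof

universe u
variable {E : Type u} [NormedAddCommGroup E] [NormedSpace ℝ E]
  {M : Type*} [TopologicalSpace M] [ChartedSpace E M] [IsManifold 𝓘(ℝ, E) ∞ M]
  {F : Type*} [NormedAddCommGroup F] [NormedSpace ℝ F]
  {C : Type*} [TopologicalSpace C] [ChartedSpace F C] [IsManifold 𝓘(ℝ, F) ∞ C]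
  {Ω : DForm E M 2} {H : M → ℝ} {XH D : VField E M} {Λ : ℝ} {π : M → C} {ε : ℤˣ} {ρ : M → ℝ}

/-- Cartan's formula with `dΩ = 0`: the symplectic form is exact with primitive `λ`. -/
theorem IsScalingSymmetry.d_interior (hΩ : IsSymplectic Ω) (hD : IsScalingSymmetry Ω H D Λ)
    (m : M) : (DForm.interior D Ω).d m = Ω m := by
  have h := hD.lieDeriv_form m
  have h0 : DForm.interior D Ω.d m = 0 := by
    unfold DForm.interior
    rw [hΩ.closed]
    rfl
  unfold DForm.lieDeriv at h
  rwa [h0, add_zero] at h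

/-- The form `λ / ρ`, where `λ = i_D Ω`. -/
def scaledForm (Ω : DForm E M 2) (D : VField E M) (ρ : M → ℝ) : DForm E M 1 := fun m =>
  (ρ m)⁻¹ • DForm.interior D Ω m

omit [IsManifold 𝓘(ℝ, E) ∞ M] in
theorem ev₁_interior (m : M) (u : E) : (DForm.interior D Ω).ev₁ m u = Ω.ev₂ m (D.toModel m) u := rfl

omit [IsManifold 𝓘(ℝ, E) ∞ M] in
theorem ev₁_scaledForm (m : M) (u : E) :
    (scaledForm Ω D ρ).ev₁ m u = (ρ m)⁻¹ * Ω.ev₂ m (D.toModel m) u := by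
  have h1 : (scaledForm Ω D ρ).ev₁ m = (ρ m)⁻¹ • (DForm.interior D Ω).ev₁ m :=
    map_smul (uncurryOne E) (ρ m)⁻¹ ((DForm.interior D Ω).toModel m)
  rw [h1]
  rfl

omit [IsManifold 𝓘(ℝ, E) ∞ M] in
theorem IsScalingFunction.contMDiff_inv (hρ : IsScalingFunction D ρ) :
    ContMDiff 𝓘(ℝ, E) 𝓘(ℝ, ℝ) ∞ fun m => (ρ m)⁻¹ := fun m =>
  (contDiffAt_inv ℝ (hρ.ne_zero m)).contMDiffAt.comp m (hρ.smooth m)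

theorem smooth_scaledForm (hΩ : IsSymplectic Ω) (hD : IsScalingSymmetry Ω H D Λ)
    (hρ : IsScalingFunction D ρ) : (scaledForm Ω D ρ).Smooth :=
  (hΩ.smooth.interior hD.smooth).smul hρ.contMDiff_inv

theorem ev₂_d_scaledForm (hΩ : IsSymplectic Ω) (hD : IsScalingSymmetry Ω H D Λ)
    (hρ : IsScalingFunction D ρ) (m : M) (u v : E) :
    (scaledForm Ω D ρ).d.ev₂ m u v = -((ρ m) ^ 2)⁻¹ * (tderiv E ℝ ρ m u * Ω.ev₂ m (D.toModel m) v -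
      tderiv E ℝ ρ m v * Ω.ev₂ m (D.toModel m) u) + (ρ m)⁻¹ * Ω.ev₂ m u v := by
  have h1 := DForm.ev₂_d_smul (hΩ.smooth.interior hD.smooth) hρ.contMDiff_inv m u v
  have h2 : ∀ w : E, tderiv E ℝ (fun m => (ρ m)⁻¹) m w = -((ρ m) ^ 2)⁻¹ * tderiv E ℝ ρ m w :=
    dfun_comp_real (hasDerivAt_inv (hρ.ne_zero m)) ((hρ.smooth m).mdifferentiableAt (by simp))
  have h3 : (DForm.interior D Ω).d.ev₂ m = Ω.ev₂ m := by
    unfold DForm.ev₂ DForm.toModel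
    rw [hD.d_interior hΩ]
  refine h1.trans ?_
  rw [h2, h2, h3, ev₁_interior, ev₁_interior]
  ring

omit [IsManifold 𝓘(ℝ, E) ∞ M] in
theorem IsScalingFunction.tderiv_field (hρ : IsScalingFunction D ρ) (m : M) :
    tderiv E ℝ ρ m (D.toModel m) = ρ m := hρ.deriv_eq m

omit [IsManifold 𝓘(ℝ, E) ∞ M] in
theorem IsScalingFunction.field_ne_zero (hρ : IsScalingFunction D ρ) (m : M) :
    D.toModel m ≠ 0 := fun h => hρ.ne_zero m (by
  rw [← hρ.tderiv_field m]
  exact (congrArg (tderiv E ℝ ρ m) h).trans (map_zero _))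

theorem IsScalingSymmetry.tderiv_field (hD : IsScalingSymmetry Ω H D Λ) (m : M) :
    tderiv E ℝ H m (D.toModel m) = Λ * H m := hD.deriv_hamiltonian m

/-- The kernel of `dπ` is a line by rank and nullity, and `D` is a nonzero vector in it. The
relation between the dimensions of `M` and `C` enters only here. -/
theorem IsOrbitSpace.exists_smul_field [FiniteDimensional ℝ E]
    (hdim : Module.finrank ℝ E = Module.finrank ℝ F + 1) (hπ : IsOrbitSpace (F := F) D π)
    (hD : D.Smooth) (hρ : IsScalingFunction D ρ) {m : M} {u : E} (hu : tderiv E F π m u = 0) :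
    ∃ c : ℝ, u = c • D.toModel m := by
  obtain ⟨L, hL⟩ := exists_rightInverse_tderiv hπ.submersion m
  have : CompleteSpace E := FiniteDimensional.complete ℝ E
  exact exists_smul_eq_of_map_eq_zero (tderiv E F π m : E →ₗ[ℝ] F) (fun w => ⟨L w, hL w⟩) hdim
    (hρ.field_ne_zero m) (hπ.tderiv_field hD m) hu

/-- Contraction of `d(λ/ρ)` with `D` gives `-ρ⁻² dρ(D) λ + ρ⁻¹ λ`, which vanishes exactly because
`dρ(D) = ρ`. -/
theorem exists_descended_scaledForm [FiniteDimensional ℝ E]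
    (hdim : Module.finrank ℝ E = Module.finrank ℝ F + 1) (hπ : IsOrbitSpace (F := F) D π)
    (hΩ : IsSymplectic Ω) (hD : IsScalingSymmetry Ω H D Λ) (hρ : IsScalingFunction D ρ) :
    ∃ η : DForm F C 1, η.Smooth ∧ ∀ m, η.pullback E π m = scaledForm Ω D ρ m := by
  refine hπ.exists_descended_form (smooth_scaledForm hΩ hD hρ) (fun m u hu => ?_)
    fun m u v hu => ?_
  · obtain ⟨c, rfl⟩ := hπ.exists_smul_field hdim hD.smooth hρ hu
    refine (uncurryOne_apply _ _).symm.trans ?_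
    refine (ev₁_scaledForm m _).trans ?_
    rw [map_smul, DForm.ev₂_self, smul_zero, mul_zero]
  · obtain ⟨c, rfl⟩ := hπ.exists_smul_field hdim hD.smooth hρ hu
    refine (uncurryTwo_apply _ _ _).symm.trans ?_
    refine (ev₂_d_scaledForm hΩ hD hρ m _ _).trans ?_
    have h := hρ.ne_zero m
    rw [map_smul, map_smul, map_smul, DForm.ev₂_self, hρ.tderiv_field, smul_apply]
    simp only [smul_eq_mul]
    field_simp
    ring

/-- `η` descends the form `λ / ρ`: it is smooth and its pullback is `λ / ρ`. -/
structure IsDescendedForm (Ω : DForm E M 2) (D : VField E M) (π : M → C) (ρ : M → ℝ)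
    (η : DForm F C 1) : Prop where
  smooth : η.Smooth
  pullback_eq : ∀ m, η.pullback E π m = scaledForm Ω D ρ m

omit [IsManifold 𝓘(ℝ, E) ∞ M] [IsManifold 𝓘(ℝ, F) ∞ C] in
theorem IsDescendedForm.ev₁_tderiv {η : DForm F C 1} (hη : IsDescendedForm Ω D π ρ η) (m : M)
    (u : E) : η.ev₁ (π m) (tderiv E F π m u) = (ρ m)⁻¹ * Ω.ev₂ m (D.toModel m) u := by
  rw [← DForm.ev₁_pullback, ← ev₁_scaledForm, funext hη.pullback_eq]

theorem IsDescendedForm.ev₂_tderiv {η : DForm F C 1} (hη : IsDescendedForm Ω D π ρ η)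
    (hπ : IsOrbitSpace (F := F) D π) (hΩ : IsSymplectic Ω) (hD : IsScalingSymmetry Ω H D Λ)
    (hρ : IsScalingFunction D ρ) (m : M) (u v : E) :
    η.d.ev₂ (π m) (tderiv E F π m u) (tderiv E F π m v) =
      -((ρ m) ^ 2)⁻¹ * (tderiv E ℝ ρ m u * Ω.ev₂ m (D.toModel m) v -
        tderiv E ℝ ρ m v * Ω.ev₂ m (D.toModel m) u) + (ρ m)⁻¹ * Ω.ev₂ m u v := by
  rw [← DForm.ev₂_pullback, ← ev₂_d_scaledForm hΩ hD hρ, ← funext hη.pullback_eq]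
  unfold DForm.ev₂ DForm.toModel
  rw [hη.smooth.d_pullback (hπ.submersion.contMDiff m)]

omit [IsManifold 𝓘(ℝ, E) ∞ M] in
theorem IsSymplectic.eq_zero_of_ev₂ (hΩ : IsSymplectic Ω) {m : M} {u : E}
    (h : ∀ v, Ω.ev₂ m u v = 0) : u = 0 :=
  hΩ.nondegenerate m u fun v => (Ω.ev₂_apply m u v).symm.trans (h v)

omit [IsManifold 𝓘(ℝ, E) ∞ M] in
theorem IsSymplectic.exists_ev₂_eq [FiniteDimensional ℝ E] (hΩ : IsSymplectic Ω) (m : M)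
    (θ : E →L[ℝ] ℝ) : ∃ u, ∀ v, Ω.ev₂ m u v = θ v :=
  exists_eq_of_nondegenerate
    ((ContinuousLinearMap.coeLM ℝ).comp (Ω.ev₂ m : E →ₗ[ℝ] E →L[ℝ] ℝ))
    (fun _ hu => hΩ.eq_zero_of_ev₂ hu) (θ : E →ₗ[ℝ] ℝ)

theorem IsOrbitSpace.exists_tderiv_eq (hπ : IsOrbitSpace (F := F) D π) (m : M) (w : F) :
    ∃ u, tderiv E F π m u = w := by
  obtain ⟨L, hL⟩ := exists_rightInverse_tderiv hπ.submersion m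
  exact ⟨L w, hL w⟩

/-- A vector projecting to the Reeb vector. -/
theorem IsDescendedForm.exists_reeb_lift [FiniteDimensional ℝ E] {η : DForm F C 1}
    (hη : IsDescendedForm Ω D π ρ η) (hπ : IsOrbitSpace (F := F) D π) (hΩ : IsSymplectic Ω)
    (hD : IsScalingSymmetry Ω H D Λ) (hρ : IsScalingFunction D ρ) (m : M) :
    ∃ r : F, η.ev₁ (π m) r = 1 ∧ ∀ v, η.d.ev₂ (π m) r v = 0 := by
  -- The lift is the Hamiltonian vector of `ρ`. Then `λ(z) = dρ(D) = ρ` and `dρ(z) = 0`, so the two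
  -- terms of `d(λ/ρ)(z, ·)` cancel.
  obtain ⟨z, hz⟩ := hΩ.exists_ev₂_eq m (-tderiv E ℝ ρ m)
  have h0 := hρ.ne_zero m
  have h1 : Ω.ev₂ m (D.toModel m) z = ρ m := by
    rw [DForm.ev₂_swap, hz, neg_apply, neg_neg, hρ.tderiv_field]
  have h2 : tderiv E ℝ ρ m z = 0 := by
    have h3 := hz z
    rw [DForm.ev₂_self, neg_apply] at h3
    linarith
  refine ⟨tderiv E F π m z, ?_, fun w => ?_⟩
  · rw [hη.ev₁_tderiv, h1, inv_mul_cancel₀ h0]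
  · obtain ⟨v, rfl⟩ := hπ.exists_tderiv_eq m w
    rw [hη.ev₂_tderiv hπ hΩ hD hρ, h1, h2, hz, neg_apply]
    field_simp
    ring

theorem IsDescendedForm.isContactForm [FiniteDimensional ℝ E]
    {η : DForm F C 1} (hη : IsDescendedForm Ω D π ρ η) (hπ : IsOrbitSpace (F := F) D π)
    (hΩ : IsSymplectic Ω) (hD : IsScalingSymmetry Ω H D Λ) (hρ : IsScalingFunction D ρ) :
    IsContactForm η where
  smooth := hη.smooth
  ne_zero c hc := by
    obtain ⟨m, rfl⟩ := hπ.surjective c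
    obtain ⟨r, hr, -⟩ := hη.exists_reeb_lift hπ hΩ hD hρ m
    have h1 : η.ev₁ (π m) = 0 := (congrArg (uncurryOne F) hc).trans (map_zero _)
    rw [h1] at hr
    simp at hr
  nondegenerate := by
    have : CompleteSpace E := FiniteDimensional.complete ℝ E
    intro c w hw hwv
    obtain ⟨m, rfl⟩ := hπ.surjective c
    obtain ⟨u, hu⟩ := hπ.exists_tderiv_eq m w
    have h0 := hρ.ne_zero m
    have h1 : Ω.ev₂ m (D.toModel m) u = 0 := by
      have h2 := (hη.ev₁_tderiv m u).symm.trans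
        ((congrArg (η.ev₁ (π m)) hu).trans ((η.ev₁_apply (π m) w).trans hw))
      exact (mul_eq_zero.1 h2).resolve_left (inv_ne_zero h0)
    -- On `ker λ` the form `d(λ/ρ)` is `Ω/ρ`, so degeneracy of `dη` on `ker η` lifts to this
    -- statement about `Ω`.
    have h3 : ∀ v, Ω.ev₂ m (D.toModel m) v = 0 → Ω.ev₂ m u v = 0 := by
      intro v hv
      have h4 : η.ev₁ (π m) (tderiv E F π m v) = 0 := by rw [hη.ev₁_tderiv, hv, mul_zero]
      have h5 := hwv (tderiv E F π m v) ((η.ev₁_apply (π m) (tderiv E F π m v)).symm.trans h4)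
      have h6 := (congrArg (fun w => η.d.ev₂ (π m) w (tderiv E F π m v)) hu).trans
        ((η.d.ev₂_apply (π m) w (tderiv E F π m v)).trans h5)
      have h7 := (hη.ev₂_tderiv hπ hΩ hD hρ m u v).symm.trans h6
      rw [h1, hv] at h7
      simpa [h0] using h7
    obtain ⟨z, hz⟩ := hΩ.exists_ev₂_eq m (-tderiv E ℝ ρ m)
    have h8 : Ω.ev₂ m (D.toModel m) z = ρ m := by
      rw [DForm.ev₂_swap, hz, neg_apply, neg_neg, hρ.tderiv_field]
    -- Every vector splits along `ker λ` and `z`, so `Ω(u, ·)` is a multiple of `λ = Ω(D, ·)`;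
    -- evaluation at `z`, where `λ(z) = ρ`, gives the factor.
    have h9 : u = (Ω.ev₂ m u z * (ρ m)⁻¹) • D.toModel m := by
      refine sub_eq_zero.1 (hΩ.eq_zero_of_ev₂ (m := m) fun v => ?_)
      have h10 : Ω.ev₂ m (D.toModel m) (v - (Ω.ev₂ m (D.toModel m) v * (ρ m)⁻¹) • z) = 0 := by
        rw [map_sub, map_smul, h8, smul_eq_mul]
        field_simp
        ring
      have h11 := h3 _ h10
      rw [map_sub, map_smul, smul_eq_mul] at h11
      rw [map_sub, sub_apply, map_smul, smul_apply, smul_eq_mul]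
      linear_combination h11
    refine hu.symm.trans ?_
    rw [h9, map_smul]
    rw [hπ.tderiv_field hD.smooth m, smul_zero]
    rfl

omit [IsManifold 𝓘(ℝ, E) ∞ M] in
theorem IsScalingFunction.contMDiff_signedPow (hρ : IsScalingFunction D ρ) (a : ℝ) :
    ContMDiff 𝓘(ℝ, E) 𝓘(ℝ, ℝ) ∞ fun m => signedPow ε a (ρ m) := fun m =>
  (contDiffAt_signedPow ε a (hρ.ne_zero m)).contMDiffAt.comp m (hρ.smooth m)

/-- The function `-H / ρ ^ Λ`. -/
def scaledHamiltonian (H : M → ℝ) (Λ : ℝ) (ε : ℤˣ) (ρ : M → ℝ) (m : M) : ℝ :=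
  -H m / signedPow ε Λ (ρ m)

-- The product form makes smoothness and the derivative follow from the product rule and the
-- derivative of the signed power.
omit [IsManifold 𝓘(ℝ, E) ∞ M] in
theorem IsScalingFunction.scaledHamiltonian_eq (hρ : IsScalingFunction D ρ) :
    scaledHamiltonian H Λ ε ρ = fun m => H m * (-signedPow ε (-Λ) (ρ m)) := by
  ext m
  have h := signedPow_mul_signedPow_neg ε Λ (hρ.ne_zero m)
  have h' := signedPow_ne_zero ε Λ (hρ.ne_zero m)
  unfold scaledHamiltonian
  rw [div_eq_iff h']
  linear_combination H m * h

omit [IsManifold 𝓘(ℝ, E) ∞ M] in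
theorem contMDiff_scaledHamiltonian (hH : ContMDiff 𝓘(ℝ, E) 𝓘(ℝ, ℝ) ∞ H)
    (hρ : IsScalingFunction D ρ) :
    ContMDiff 𝓘(ℝ, E) 𝓘(ℝ, ℝ) ∞ (scaledHamiltonian H Λ ε ρ) := by
  rw [hρ.scaledHamiltonian_eq]
  exact hH.mul (hρ.contMDiff_signedPow _).neg

omit [IsManifold 𝓘(ℝ, E) ∞ M] in
theorem tderiv_scaledHamiltonian (hH : ContMDiff 𝓘(ℝ, E) 𝓘(ℝ, ℝ) ∞ H)
    (hρ : IsScalingFunction D ρ) (m : M) (v : E) :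
    tderiv E ℝ (scaledHamiltonian H Λ ε ρ) m v =
      (signedPow ε Λ (ρ m))⁻¹ * (Λ * H m * tderiv E ℝ ρ m v / ρ m - tderiv E ℝ H m v) := by
  have h0 := hρ.ne_zero m
  have h1 : tderiv E ℝ (fun m => -signedPow ε (-Λ) (ρ m)) m v =
      -(-Λ * signedPow ε (-Λ) (ρ m) / ρ m) * tderiv E ℝ ρ m v :=
    dfun_comp_real (hasDerivAt_signedPow ε (-Λ) h0).neg ((hρ.smooth m).mdifferentiableAt (by simp)) v
  have h2 : tderiv E ℝ (fun m => H m * (-signedPow ε (-Λ) (ρ m))) m v =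
      H m * tderiv E ℝ (fun m => -signedPow ε (-Λ) (ρ m)) m v +
        -signedPow ε (-Λ) (ρ m) * tderiv E ℝ H m v :=
    dfun_mul ((hH m).mdifferentiableAt (by simp))
      ((hρ.contMDiff_signedPow (-Λ)).neg.mdifferentiableAt (by simp)) v
  rw [hρ.scaledHamiltonian_eq, h2, h1,
    ← eq_inv_of_mul_eq_one_right (signedPow_mul_signedPow_neg ε Λ h0)]
  field_simp
  ring

theorem deriv_scaledHamiltonian (hH : ContMDiff 𝓘(ℝ, E) 𝓘(ℝ, ℝ) ∞ H)
    (hD : IsScalingSymmetry Ω H D Λ) (hρ : IsScalingFunction D ρ) (m : M) :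
    D.deriv (scaledHamiltonian H Λ ε ρ) m = 0 := by
  refine (tderiv_scaledHamiltonian hH hρ m (D.toModel m)).trans ?_
  rw [hρ.tderiv_field, hD.tderiv_field, mul_div_cancel_right₀ _ (hρ.ne_zero m), sub_self, mul_zero]

end ReductionProof

/-! ### The reduced field as a rescaled push-forward -/

section ReducedField

universe u
variable {E : Type u} [NormedAddCommGroup E] [NormedSpace ℝ E]
  {M : Type*} [TopologicalSpace M] [ChartedSpace E M] [IsManifold 𝓘(ℝ, E) ∞ M]
  {F : Type*} [NormedAddCommGroup F] [NormedSpace ℝ F]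
  {C : Type*} [TopologicalSpace C] [ChartedSpace F C] [IsManifold 𝓘(ℝ, F) ∞ C]
  {Ω : DForm E M 2} {H : M → ℝ} {XH D : VField E M} {Λ : ℝ} {π : M → C} {ε : ℤˣ} {ρ : M → ℝ}
  {η : DForm F C 1} {h : C → ℝ} {c : ContactData F C}

variable (F) in
/-- The vector `ρ ^ (1 - Λ) π_* X` at the image of a point. -/
def scaledPush (X : VField E M) (Λ : ℝ) (ε : ℤˣ) (π : M → C) (ρ : M → ℝ) (m : M) : F :=
  (ρ m / signedPow ε Λ (ρ m)) • tderiv E F π m (X.toModel m)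

omit [IsManifold 𝓘(ℝ, E) ∞ M] in
theorem IsHamiltonianField.ev₂_eq (hXH : IsHamiltonianField Ω H XH) (m : M) (v : E) :
    Ω.ev₂ m (XH.toModel m) v = -tderiv E ℝ H m v :=
  (Ω.ev₂_apply m (XH m) v).trans (hXH m v)

theorem ev₂_field_hamiltonianField (hXH : IsHamiltonianField Ω H XH)
    (hD : IsScalingSymmetry Ω H D Λ) (m : M) :
    Ω.ev₂ m (D.toModel m) (XH.toModel m) = Λ * H m := by
  rw [DForm.ev₂_swap, hXH.ev₂_eq, neg_neg, ← hD.tderiv_field]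

-- The pairing is `ρ^(-Λ) λ(X_H)`, and `λ(X_H) = dH(D) = ΛH`.
omit [IsManifold 𝓘(ℝ, F) ∞ C] in
theorem IsDescendedForm.ev₁_scaledPush (hη : IsDescendedForm Ω D π ρ η)
    (hXH : IsHamiltonianField Ω H XH) (hD : IsScalingSymmetry Ω H D Λ)
    (hρ : IsScalingFunction D ρ) (hh : ∀ m, h (π m) = scaledHamiltonian H Λ ε ρ m) (m : M) :
    η.ev₁ (π m) (scaledPush F XH Λ ε π ρ m) = -Λ * h (π m) := by
  have h0 := hρ.ne_zero m
  have h1 := signedPow_ne_zero ε Λ h0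
  unfold scaledPush
  rw [map_smul, hη.ev₁_tderiv, ev₂_field_hamiltonianField hXH hD, hh, scaledHamiltonian,
    smul_eq_mul]
  field_simp

theorem IsDescendedForm.ev₂_scaledPush (hη : IsDescendedForm Ω D π ρ η)
    (hπ : IsOrbitSpace (F := F) D π) (hΩ : IsSymplectic Ω)
    (hH : ContMDiff 𝓘(ℝ, E) 𝓘(ℝ, ℝ) ∞ H)
    (hXH : IsHamiltonianField Ω H XH) (hD : IsScalingSymmetry Ω H D Λ)
    (hρ : IsScalingFunction D ρ) (hhs : ContMDiff 𝓘(ℝ, F) 𝓘(ℝ, ℝ) ∞ h)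
    (hh : ∀ m, h (π m) = scaledHamiltonian H Λ ε ρ m) (m : M) {r : F}
    (hr1 : η.ev₁ (π m) r = 1) (hr2 : ∀ v, η.d.ev₂ (π m) r v = 0) (y : F) :
    η.d.ev₂ (π m) (scaledPush F XH Λ ε π ρ m) y =
      tderiv F ℝ h (π m) y - tderiv F ℝ h (π m) r * η.ev₁ (π m) y := by
  have h0 := hρ.ne_zero m
  have h1 := signedPow_ne_zero ε Λ h0
  -- Direct computation gives `dh` minus a multiple of `η` with factor `dρ(X_H)/ρ^Λ`. Inserting the
  -- Reeb vector `r`, which kills the left side, identifies that factor with `dh(r)`.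
  have key : ∀ y, η.d.ev₂ (π m) (scaledPush F XH Λ ε π ρ m) y = tderiv F ℝ h (π m) y -
      tderiv E ℝ ρ m (XH.toModel m) / signedPow ε Λ (ρ m) * η.ev₁ (π m) y := by
    intro y
    obtain ⟨v, rfl⟩ := hπ.exists_tderiv_eq m y
    have h2 : tderiv F ℝ h (π m) (tderiv E F π m v) =
        tderiv E ℝ (scaledHamiltonian H Λ ε ρ) m v := by
      rw [← funext hh]
      exact (congrArg (fun L : E →L[ℝ] ℝ => L v)
        (tderiv_comp (G := E) (F := ℝ) ((hhs (π m)).mdifferentiableAt (by simp))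
          ((hπ.submersion.contMDiff m).mdifferentiableAt (by simp)))).symm
    unfold scaledPush
    rw [h2, tderiv_scaledHamiltonian hH hρ, map_smul, smul_apply, hη.ev₂_tderiv hπ hΩ hD hρ,
      hη.ev₁_tderiv, ev₂_field_hamiltonianField hXH hD, hXH.ev₂_eq, smul_eq_mul]
    field_simp
    ring
  have h3 := key r
  rw [DForm.ev₂_swap, hr2, hr1] at h3
  rw [key y]
  linear_combination -(η.ev₁ (π m) y) * h3

theorem IsContactReduction.isDescendedForm (hc : IsContactReduction Ω H D Λ ε π ρ c) :
    IsDescendedForm Ω D π ρ c.η :=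
  ⟨hc.contact.smooth, hc.pullback_form⟩

theorem IsReebField.ev₂_eq {R : VField F C} (hR : IsReebField η R) (x : C) (v : F) :
    η.d.ev₂ x (R.toModel x) v = 0 :=
  (η.d.ev₂_apply x (R x) v).trans (hR.d_eq x v)

theorem IsReebField.ev₁_eq {R : VField F C} (hR : IsReebField η R) (x : C) :
    η.ev₁ x (R.toModel x) = 1 :=
  (η.ev₁_apply x (R x)).trans (hR.apply_eq x)

theorem IsContactHamiltonianField.ev₂_eq {R X : VField F C}
    (hX : IsContactHamiltonianField η R h X) (x : C) (v : F) :
    η.d.ev₂ x (X.toModel x) v =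
      tderiv F ℝ h x v - tderiv F ℝ h x (R.toModel x) * η.ev₁ x v :=
  (η.d.ev₂_apply x (X x) v).trans ((hX.d_eq x v).trans
    (congrArg (fun z => tderiv F ℝ h x v - tderiv F ℝ h x (R.toModel x) * z)
      (η.ev₁_apply x v).symm))

theorem IsContactHamiltonianField.ev₁_eq {R X : VField F C}
    (hX : IsContactHamiltonianField η R h X) (x : C) : η.ev₁ x (X.toModel x) = -h x :=
  (η.ev₁_apply x (X x)).trans (hX.apply_eq x)

/-- The reduced field is the push-forward of the Hamiltonian field times `ρ ^ (1 - Λ)`. -/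
theorem IsContactReduction.reducedField_eq (hc : IsContactReduction Ω H D Λ ε π ρ c)
    (hπ : IsOrbitSpace (F := F) D π) (hΩ : IsSymplectic Ω)
    (hH : ContMDiff 𝓘(ℝ, E) 𝓘(ℝ, ℝ) ∞ H)
    (hXH : IsHamiltonianField Ω H XH) (hD : IsScalingSymmetry Ω H D Λ)
    (hρ : IsScalingFunction D ρ) (m : M) :
    c.reducedField Λ (π m) = scaledPush F XH Λ ε π ρ m := by
  have e : c.reducedField Λ (π m) =
      c.V.toModel (π m) + ((1 - Λ) * c.h (π m)) • c.R.toModel (π m) := rfl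
  rw [e]
  -- On `η` both sides give `-h + (1 - Λ)h = -Λh`. On `dη` the Reeb term contributes nothing.
  refine hc.contact.eq_of_forall (x := π m) ?_ fun v => ?_
  · rw [hc.isDescendedForm.ev₁_scaledPush hXH hD hρ hc.pullback_hamiltonian, map_add, map_smul,
      hc.field.ev₁_eq, hc.reeb.ev₁_eq, smul_eq_mul]
    ring
  · rw [hc.isDescendedForm.ev₂_scaledPush hπ hΩ hH hXH hD hρ hc.smooth_hamiltonian
      hc.pullback_hamiltonian m (hc.reeb.ev₁_eq _) (hc.reeb.ev₂_eq _), map_add, map_smul,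
      add_apply, smul_apply, hc.field.ev₂_eq, hc.reeb.ev₂_eq, smul_zero, add_zero]

theorem exists_isContactReduction [FiniteDimensional ℝ E] [FiniteDimensional ℝ F]
    (hdim : Module.finrank ℝ E = Module.finrank ℝ F + 1)
    (hπ : IsOrbitSpace (F := F) D π) (hΩ : IsSymplectic Ω)
    (hH : ContMDiff 𝓘(ℝ, E) 𝓘(ℝ, ℝ) ∞ H)
    (hXH : IsHamiltonianField Ω H XH) (hD : IsScalingSymmetry Ω H D Λ)
    (hρ : IsScalingFunction D ρ) :
    ∃ c : ContactData F C, IsContactReduction Ω H D Λ ε π ρ c := by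
  obtain ⟨η, hηs, hη⟩ := exists_descended_scaledForm hdim hπ hΩ hD hρ
  have hη' : IsDescendedForm Ω D π ρ η := ⟨hηs, hη⟩
  have hcont := hη'.isContactForm hπ hΩ hD hρ
  obtain ⟨h, hhs, hh⟩ := hπ.exists_descended_function
    (contMDiff_scaledHamiltonian (Λ := Λ) (ε := ε) hH hρ) (deriv_scaledHamiltonian hH hD hρ)
  have hreeb : ∀ x : C, ∃ r : F, η.ev₁ x r = 1 ∧ ∀ v, η.d.ev₂ x r v = 0 := by
    intro x
    obtain ⟨m, rfl⟩ := hπ.surjective x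
    exact hη'.exists_reeb_lift hπ hΩ hD hρ m
  choose r hr1 hr2 using hreeb
  let R : VField F C := r
  have hR : IsReebField η R := by
    refine ⟨?_, fun x v => (η.d.ev₂_apply x (R x) v).symm.trans (hr2 x v),
      fun x => (η.ev₁_apply x (R x)).symm.trans (hr1 x)⟩
    -- The Reeb field solves `i_R dη + η(R)η = η`.
    refine hcont.smooth_of_forall (f := fun _ => 0) (g := fun _ => 1) contMDiff_const
      contMDiff_const fun x v => ?_
    have h1 : tderiv F ℝ (fun _ : C => (0 : ℝ)) x = 0 := mfderiv_const
    change η.d.ev₂ x (r x) v + η.ev₁ x (r x) * η.ev₁ x v = _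
    rw [hr1, hr2, h1]
    simp
  have hfield : ∀ x : C, ∃ w : F, η.ev₁ x w = -h x ∧
      ∀ v, η.d.ev₂ x w v = tderiv F ℝ h x v - tderiv F ℝ h x (r x) * η.ev₁ x v := by
    intro x
    obtain ⟨m, rfl⟩ := hπ.surjective x
    -- The reduced-field identity solved for the contact Hamiltonian vector, at any point `m` of the
    -- fibre.
    refine ⟨scaledPush F XH Λ ε π ρ m - ((1 - Λ) * h (π m)) • r (π m), ?_, fun v => ?_⟩
    · rw [map_sub, map_smul, hη'.ev₁_scaledPush hXH hD hρ hh, hr1, smul_eq_mul]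
      ring
    · rw [map_sub, map_smul, sub_apply, smul_apply, hr2, smul_zero, sub_zero,
        hη'.ev₂_scaledPush hπ hΩ hH hXH hD hρ hhs hh m (hr1 _) (hr2 _)]
  choose w hw1 hw2 using hfield
  let V : VField F C := w
  refine ⟨⟨η, h, R, V⟩, ⟨hcont, hη, hhs, hh, hR, ?_, fun x v => ?_,
    fun x => (η.ev₁_apply x (V x)).symm.trans (hw1 x)⟩⟩
  -- The defining equations combine to `i_V dη + η(V)η = dh - (R(h) + h)η`.
  · refine hcont.smooth_of_forall (f := h) (g := fun x => -(R.deriv h x) + -h x) hhs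
      ((hR.smooth.contMDiff_deriv hhs).neg.add hhs.neg) fun x v => ?_
    change η.d.ev₂ x (w x) v + η.ev₁ x (w x) * η.ev₁ x v =
      tderiv F ℝ h x v + (-(tderiv F ℝ h x (r x)) + -h x) * η.ev₁ x v
    rw [hw1, hw2]
    ring
  · refine (η.d.ev₂_apply x (V x) v).symm.trans ((hw2 x v).trans ?_)
    exact congrArg (fun z => tderiv F ℝ h x v - tderiv F ℝ h x (r x) * z) (η.ev₁_apply x v)

/-- The form and the function are fixed by their pullbacks, since `π` and `dπ` are onto; the fields
are then fixed by their pairings with `η` and `dη`. -/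
theorem IsContactReduction.eq {c' : ContactData F C} (hπ : IsOrbitSpace (F := F) D π)
    (hc : IsContactReduction Ω H D Λ ε π ρ c) (hc' : IsContactReduction Ω H D Λ ε π ρ c') :
    c = c' := by
  have h1 : c.η = c'.η := by
    ext1 x
    obtain ⟨m, rfl⟩ := hπ.surjective x
    refine DForm.ext₁ fun v => ?_
    obtain ⟨u, rfl⟩ := hπ.exists_tderiv_eq m v
    rw [hc.isDescendedForm.ev₁_tderiv, hc'.isDescendedForm.ev₁_tderiv]
  have h2 : c.h = c'.h := by
    ext x
    obtain ⟨m, rfl⟩ := hπ.surjective x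
    rw [hc.pullback_hamiltonian, hc'.pullback_hamiltonian]
  have h3 : c.R = c'.R := by
    ext1 x
    refine hc.contact.eq_of_forall (x := x) (u := c.R.toModel x) (u' := c'.R.toModel x) ?_
      fun v => ?_
    · rw [hc.reeb.ev₁_eq, h1, hc'.reeb.ev₁_eq]
    · rw [hc.reeb.ev₂_eq, h1, hc'.reeb.ev₂_eq]
  have h4 : c.V = c'.V := by
    ext1 x
    refine hc.contact.eq_of_forall (x := x) (u := c.V.toModel x) (u' := c'.V.toModel x) ?_
      fun v => ?_
    · rw [hc.field.ev₁_eq, h1, hc'.field.ev₁_eq, h2]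
    · rw [hc.field.ev₂_eq, h1, hc'.field.ev₂_eq, h2, h3]
  cases c
  cases c'
  simp_all

theorem IsContactReduction.isPushforwardLineField (hc : IsContactReduction Ω H D Λ ε π ρ c)
    (hπ : IsOrbitSpace (F := F) D π) (hΩ : IsSymplectic Ω)
    (hH : ContMDiff 𝓘(ℝ, E) 𝓘(ℝ, ℝ) ∞ H)
    (hXH : IsHamiltonianField Ω H XH) (hD : IsScalingSymmetry Ω H D Λ)
    (hρ : IsScalingFunction D ρ) :
    IsPushforwardLineField π XH (fun x => Submodule.span ℝ {c.reducedField Λ x}) := by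
  intro m
  have h0 := hρ.ne_zero m
  have h1 : ρ m / signedPow ε Λ (ρ m) ≠ 0 := div_ne_zero h0 (signedPow_ne_zero ε Λ h0)
  have h2 : (Submodule.span ℝ {c.reducedField Λ (π m)} : Submodule ℝ F) =
      Submodule.span ℝ {tderiv E F π m (XH.toModel m)} := by
    rw [hc.reducedField_eq hπ hΩ hH hXH hD hρ m]
    exact Submodule.span_singleton_smul_eq (IsUnit.mk0 _ h1) _
  refine Eq.trans ?_ h2.symm
  unfold pushLine
  rw [Submodule.map_span, Set.image_singleton]
  rfl

/-- Both reduced fields are multiples of the same vector `dπ(X_H)`, with factors `ρ^(1-Λ)` and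
`ρ'^(1-Λ)`. The ratio `ρ'/ρ` has degree zero, so it descends. -/
theorem IsContactReduction.exists_scaling_ratio {ρ' : M → ℝ} {c' : ContactData F C}
    (hc : IsContactReduction Ω H D Λ ε π ρ c) (hc' : IsContactReduction Ω H D Λ ε π ρ' c')
    (hπ : IsOrbitSpace (F := F) D π) (hΩ : IsSymplectic Ω)
    (hH : ContMDiff 𝓘(ℝ, E) 𝓘(ℝ, ℝ) ∞ H)
    (hXH : IsHamiltonianField Ω H XH) (hD : IsScalingSymmetry Ω H D Λ)
    (hρ : IsScalingFunction D ρ) (hρ' : IsScalingFunction D ρ') :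
    ∃ s : C → ℝ, ContMDiff 𝓘(ℝ, F) 𝓘(ℝ, ℝ) ∞ s ∧ (∀ m, s (π m) = ρ' m / ρ m) ∧
      ∀ x, c'.reducedField Λ x = signedPow (-ε) (1 - Λ) (s x) • c.reducedField Λ x := by
  have hf : ContMDiff 𝓘(ℝ, E) 𝓘(ℝ, ℝ) ∞ fun m => ρ' m * (ρ m)⁻¹ :=
    hρ'.smooth.mul hρ.contMDiff_inv
  have hDf : ∀ m, D.deriv (fun m => ρ' m * (ρ m)⁻¹) m = 0 := by
    intro m
    have h0 := hρ.ne_zero m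
    have h1 : tderiv E ℝ (fun m => (ρ m)⁻¹) m (D.toModel m) =
        -((ρ m) ^ 2)⁻¹ * tderiv E ℝ ρ m (D.toModel m) :=
      dfun_comp_real (hasDerivAt_inv h0) ((hρ.smooth m).mdifferentiableAt (by simp)) _
    have h2 : tderiv E ℝ (fun m => ρ' m * (ρ m)⁻¹) m (D.toModel m) =
        ρ' m * tderiv E ℝ (fun m => (ρ m)⁻¹) m (D.toModel m) +
          (ρ m)⁻¹ * tderiv E ℝ ρ' m (D.toModel m) :=
      dfun_mul ((hρ'.smooth m).mdifferentiableAt (by simp))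
        ((hρ.contMDiff_inv m).mdifferentiableAt (by simp)) _
    refine h2.trans ?_
    rw [h1, hρ.tderiv_field, hρ'.tderiv_field]
    field_simp
    ring
  obtain ⟨s, hs, hsπ⟩ := hπ.exists_descended_function hf hDf
  refine ⟨s, hs, fun m => by rw [hsπ, div_eq_mul_inv], fun x => ?_⟩
  obtain ⟨m, rfl⟩ := hπ.surjective x
  have h0 := hρ.ne_zero m
  have h0' := hρ'.ne_zero m
  rw [hc.reducedField_eq hπ hΩ hH hXH hD hρ m, hc'.reducedField_eq hπ hΩ hH hXH hD hρ' m, hsπ,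
    ← div_eq_mul_inv, signedPow_div _ _ h0 h0', signedPow_neg_one_sub _ _ h0,
    signedPow_neg_one_sub _ _ h0']
  unfold scaledPush
  refine Eq.trans ?_ (smul_smul _ _ _).symm
  rw [div_mul_cancel₀ _ (div_ne_zero h0 (signedPow_ne_zero ε Λ h0))]
  rfl

end ReducedField

end ScalingReduction

end

/-! ### The reduction theorem -/

theorem mainTheorem3 (n : ℕ)
    {M : Type*} [TopologicalSpace M] [T2Space M]
    [ChartedSpace (EuclideanSpace ℝ (Fin (2 * n + 2))) M]
    [IsManifold 𝓘(ℝ, EuclideanSpace ℝ (Fin (2 * n + 2))) ∞ M]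
    {C : Type*} [TopologicalSpace C] [T2Space C]
    [ChartedSpace (EuclideanSpace ℝ (Fin (2 * n + 1))) C]
    [IsManifold 𝓘(ℝ, EuclideanSpace ℝ (Fin (2 * n + 1))) ∞ C]
    (Ω : ScalingReduction.DForm (EuclideanSpace ℝ (Fin (2 * n + 2))) M 2)
    (hΩ : ScalingReduction.IsSymplectic Ω)
    (H : M → ℝ)
    (hH : ContMDiff 𝓘(ℝ, EuclideanSpace ℝ (Fin (2 * n + 2))) 𝓘(ℝ, ℝ) ∞ H)
    (XH : ScalingReduction.VField (EuclideanSpace ℝ (Fin (2 * n + 2))) M)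
    (hXH : ScalingReduction.IsHamiltonianField Ω H XH)
    (D : ScalingReduction.VField (EuclideanSpace ℝ (Fin (2 * n + 2))) M) (Λ : ℝ)
    (hD : ScalingReduction.IsScalingSymmetry Ω H D Λ)
    (π : M → C)
    (hπ : ScalingReduction.IsOrbitSpace (F := EuclideanSpace ℝ (Fin (2 * n + 1))) D π)
    (ε : ℤˣ) :
    (∀ ρ : M → ℝ, ScalingReduction.IsScalingFunction D ρ →
      ∃! c : ScalingReduction.ContactData (EuclideanSpace ℝ (Fin (2 * n + 1))) C,
        ScalingReduction.IsContactReduction Ω H D Λ ε π ρ c) ∧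
    (∀ ρ : M → ℝ, ScalingReduction.IsScalingFunction D ρ →
      ∀ c : ScalingReduction.ContactData (EuclideanSpace ℝ (Fin (2 * n + 1))) C,
        ScalingReduction.IsContactReduction Ω H D Λ ε π ρ c →
        ScalingReduction.IsPushforwardLineField π XH
          (fun x => Submodule.span ℝ {c.reducedField Λ x})) ∧
    (∀ ρ ρ' : M → ℝ, ScalingReduction.IsScalingFunction D ρ →
      ScalingReduction.IsScalingFunction D ρ' →
      ∀ c c' : ScalingReduction.ContactData (EuclideanSpace ℝ (Fin (2 * n + 1))) C,
        ScalingReduction.IsContactReduction Ω H D Λ ε π ρ c →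
        ScalingReduction.IsContactReduction Ω H D Λ ε π ρ' c' →
        ∃ s : C → ℝ,
          ContMDiff 𝓘(ℝ, EuclideanSpace ℝ (Fin (2 * n + 1))) 𝓘(ℝ, ℝ) ∞ s ∧
          (∀ m, s (π m) = ρ' m / ρ m) ∧
          ∀ x, c'.reducedField Λ x =
            ScalingReduction.signedPow (-ε) (1 - Λ) (s x) • c.reducedField Λ x) := by
  have hdim : Module.finrank ℝ (EuclideanSpace ℝ (Fin (2 * n + 2))) =
      Module.finrank ℝ (EuclideanSpace ℝ (Fin (2 * n + 1))) + 1 := by simp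
  refine ⟨fun ρ hρ => ?_, fun ρ hρ c hc => hc.isPushforwardLineField hπ hΩ hH hXH hD hρ,
    fun ρ ρ' hρ hρ' c c' hc hc' => hc.exists_scaling_ratio hc' hπ hΩ hH hXH hD hρ hρ'⟩
  obtain ⟨c, hc⟩ := ScalingReduction.exists_isContactReduction hdim hπ hΩ hH hXH hD hρ
  exact ⟨c, hc, fun c' hc' => hc'.eq hπ hc⟩
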